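/- Let $M$ be a smooth manifold (Hausdorff, second countable, without boundary) of dimension $n$, equipped with a smooth strictly positive density $\mathrm{d}x$ (for instance the volume density of a Lorentzian or Riemannian metric), and let $E \to M$ be a smooth complex vector bundle of finite rank with a smooth positive-definite hermitian inner product $\langle\cdot,\cdot\rangle$ on its fibres. Write $C_0^\infty(M;E)$ for the compactly supported smooth sections and $L^2(M;E)$ for the Hilbert space completion of $C_0^\infty(M;E)$ with respect to $\langle u,v\rangle=\int_M\langle u(x),v(x)\rangle\,\mathrm{d}x$. For a smooth kernel $k\in C^\infty(M\times M;E\boxtimes E^*)$, i.e. a smooth family of linear maps $k(x,y):E_y\to E_x$, we say that an operator $A$ in $L^2(M;E)$ has integral kernel $k$ if $C_0^\infty(M;E)$ is contained in its domain and $\langle v,Au\rangle=\int_M\int_M\langle v(x),k(x,y)u(y)\rangle\,\mathrm{d}y\,\mathrm{d}x$ for all $u,v\in C_0^\infty(M;E)$. Let $K\in C^\infty(M\times M;E\boxtimes E^*)$ be properly supported (for every compact $C\subset M$ the sets $\operatorname{supp}K\cap(C\times M)$ and $\operatorname{supp}K\cap(M\times C)$ are compact) and non-negative, i.e. $\int_M\int_M\langle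 u(x),K(x,y)u(y)\rangle\,\mathrm{d}y\,\mathrm{d}x\ge 0$ for all $u\in C_0^\infty(M;E)$. Then: 1. The operator that $K$ defines on $C_0^\infty(M;E)$ has at least one (possibly unbounded) non-negative self-adjoint extension in $L^2(M;E)$. 2. For every such extension, again denoted by $K$, the operator $\mathrm{id}+K$ has a bounded everywhere defined inverse, and for the bounded operator $T=(\mathrm{id}+K)^{-1/2}$ given by the spectral calculus (that is, $T=\sqrt{(\mathrm{id}+K)^{-1}}$), the operator $\mathrm{id}-T$ is a non-negative operator on $L^2(M;E)$ which has a smooth integral kernel in $C^\infty(M\times M;E\boxtimes E^*)$. -/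

import Mathlib

open MeasureTheory Bundle
open scoped Manifold ContDiff ComplexOrder

noncomputable section

namespace SmoothKernel

/-! ### Smooth positive densities -/

/-- `μ` is (integration against) a smooth positive density on the `n`-dimensional manifold `M`:
in every chart it is Lebesgue measure times a smooth, strictly positive function.  The volume
densities of Riemannian and Lorentzian metrics are of this form. -/
class IsSmoothPositiveDensity (n : ℕ) {M : Type*} [TopologicalSpace M]
    [ChartedSpace (EuclideanSpace ℝ (Fin n)) M] [MeasurableSpace M] (μ : Measure M) : Prop where
  exists_density : ∀ e ∈ atlas (EuclideanSpace ℝ (Fin n)) M,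
    ∃ ρ : EuclideanSpace ℝ (Fin n) → ℝ,
      ContDiffOn ℝ ∞ ρ e.target ∧ (∀ z ∈ e.target, 0 < ρ z) ∧
      (μ.restrict e.source).map e =
        (volume.restrict e.target).withDensity (fun z => ENNReal.ofReal (ρ z))

theorem IsSmoothPositiveDensity.isLocallyFiniteMeasure (n : ℕ) {M : Type*} [TopologicalSpace M]
    [ChartedSpace (EuclideanSpace ℝ (Fin n)) M] [MeasurableSpace M] [BorelSpace M]
    (μ : Measure M) [h : IsSmoothPositiveDensity n μ] : IsLocallyFiniteMeasure μ := by
  refine ⟨fun x => ?_⟩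
  set e := chartAt (EuclideanSpace ℝ (Fin n)) x with he
  obtain ⟨ρ, hρ, -, hμ⟩ := h.exists_density e (chart_mem_atlas _ x)
  have hx : x ∈ e.source := mem_chart_source _ x
  obtain ⟨C, hC, hxC, hCt⟩ := exists_compact_subset e.open_target (e.map_source hx)
  refine ⟨e.source ∩ e ⁻¹' interior C, (e.isOpen_inter_preimage isOpen_interior).mem_nhds
    ⟨hx, hxC⟩, ?_⟩
  have hae : AEMeasurable e (μ.restrict e.source) :=
    e.continuousOn.aemeasurable e.open_source.measurableSet
  have h1 : μ (e.source ∩ e ⁻¹' interior C) =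
      (μ.restrict e.source).map e (interior C) := by
    rw [Measure.map_apply_of_aemeasurable hae isOpen_interior.measurableSet,
      Measure.restrict_apply₀' e.open_source.measurableSet.nullMeasurableSet, Set.inter_comm]
  rw [h1, hμ]
  refine lt_of_le_of_lt (measure_mono interior_subset) ?_
  rw [withDensity_apply _ hC.measurableSet, Measure.restrict_restrict hC.measurableSet,
    Set.inter_eq_left.2 hCt]
  have hint : IntegrableOn ρ C := (hρ.continuousOn.mono hCt).integrableOn_compact hC
  exact hint.lintegral_lt_top

/-! ### Smooth compactly supported sections and the Hilbert space of square-integrable sections -/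

section Sections

variable (n : ℕ) {M : Type*} [TopologicalSpace M] [ChartedSpace (EuclideanSpace ℝ (Fin n)) M]
  (F : Type*) [NormedAddCommGroup F] [NormedSpace ℂ F]
  (E : M → Type*) [TopologicalSpace (TotalSpace F E)] [∀ x, NormedAddCommGroup (E x)]
  [∀ x, InnerProductSpace ℂ (E x)] [FiberBundle F E] [VectorBundle ℂ F E] [VectorBundle ℝ F E]

/-- The inner products on the fibres of `E` depend smoothly on the base point.  (The hermitian
inner product is smooth if and only if its real part is.) -/
class IsSmoothHermitianBundle : Prop where
  isContMDiffRiemannianBundle :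
    letI : ∀ x, InnerProductSpace ℝ (E x) := fun _ => InnerProductSpace.complexToReal
    IsContMDiffRiemannianBundle (𝓡 n) ∞ F E

/-- The section `u` of `E` is smooth. -/
def IsSmoothSection (u : ∀ x, E x) : Prop :=
  ContMDiff (𝓡 n) ((𝓡 n).prod 𝓘(ℝ, F)) ∞ (fun x => TotalSpace.mk' F x (u x))

variable {n F E}

theorem IsSmoothSection.complex_smul {u : ∀ x, E x} (hu : IsSmoothSection n F E u) (c : ℂ) :
    IsSmoothSection n F E (c • u) := by
  intro x₀
  have h := hu x₀
  rw [contMDiffAt_section] at h ⊢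
  set e := trivializationAt F E x₀
  have hc : ContMDiffAt (𝓡 n) 𝓘(ℝ, F) ∞ (fun x => c • (e ⟨x, u x⟩).2) x₀ := by
    have hL : ContDiff ℝ ∞ (fun v : F => c • v) := contDiff_const_smul c
    exact hL.contMDiff.contMDiffAt.comp x₀ h
  refine hc.congr_of_eventuallyEq ?_
  filter_upwards [e.open_baseSet.mem_nhds (FiberBundle.mem_baseSet_trivializationAt' x₀)] with x hx
  exact (e.linear ℂ hx).2 c (u x)

variable (n F E)

/-- The complex vector space `C₀^∞(M; E)` of smooth sections vanishing outside a compact set. -/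
def testSections : Submodule ℂ (∀ x, E x) where
  carrier := {u | IsSmoothSection n F E u ∧ ∃ C : Set M, IsCompact C ∧ ∀ x, x ∉ C → u x = 0}
  add_mem' := by
    rintro u v ⟨hu, C, hC, huC⟩ ⟨hv, D, hD, hvD⟩
    refine ⟨ContMDiff.add_section hu hv, C ∪ D, hC.union hD, fun x hx => ?_⟩
    rw [Set.mem_union, not_or] at hx
    simp [huC x hx.1, hvD x hx.2]
  zero_mem' := ⟨contMDiff_zeroSection ℝ E, ∅, isCompact_empty, fun _ _ => rfl⟩
  smul_mem' := by
    rintro c u ⟨hu, C, hC, huC⟩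
    exact ⟨hu.complex_smul c, C, hC, fun x hx => by simp [huC x hx]⟩

variable [MeasurableSpace M] (μ : Measure M)

/-- A copy of `C₀^∞(M; E)`, to be endowed with the inner product of `L²(M; E)` with respect
to `μ`. -/
def TestSection (_μ : Measure M) : Type _ := testSections n F E

instance : AddCommGroup (TestSection n F E μ) :=
  inferInstanceAs (AddCommGroup (testSections n F E))

instance : Module ℂ (TestSection n F E μ) :=
  inferInstanceAs (Module ℂ (testSections n F E))

instance : CoeFun (TestSection n F E μ) (fun _ => ∀ x, E x) := ⟨fun u => u.1⟩

variable {n F E μ}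

theorem TestSection.continuous_inner [IsSmoothHermitianBundle n F E] (u v : TestSection n F E μ) :
    Continuous (fun x => inner ℂ (u x) (v x)) := by
  let _ : ∀ x, InnerProductSpace ℝ (E x) := fun _ => InnerProductSpace.complexToReal
  have : IsContMDiffRiemannianBundle (𝓡 n) ∞ F E :=
    IsSmoothHermitianBundle.isContMDiffRiemannianBundle
  have key : ∀ a b : ∀ x, E x, IsSmoothSection n F E a → IsSmoothSection n F E b →
      Continuous (fun x => (inner ℂ (a x) (b x)).re) := fun a b ha hb =>
    (ContMDiff.inner_bundle (b := fun x : M => x) ha hb).continuous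
  have hre := key u v u.2.1 v.2.1
  have him := key (Complex.I • u.1) v (u.2.1.complex_smul _) v.2.1
  have : (fun x => inner ℂ (u x) (v x)) = fun x =>
      ((inner ℂ (u x) (v x)).re : ℂ) +
        ((inner ℂ ((Complex.I • u.1) x) (v x)).re : ℂ) * Complex.I := by
    funext x
    rw [Pi.smul_apply, inner_smul_left]
    apply Complex.ext <;> simp
  rw [this]
  fun_prop

theorem TestSection.integrable_inner [T2Space M] [BorelSpace M] [IsSmoothHermitianBundle n F E]
    [IsSmoothPositiveDensity n μ] (u v : TestSection n F E μ) :
    Integrable (fun x => inner ℂ (u x) (v x)) μ := by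
  have := IsSmoothPositiveDensity.isLocallyFiniteMeasure n μ
  obtain ⟨C, hC, huC⟩ := u.2.2
  refine (TestSection.continuous_inner u v).integrable_of_hasCompactSupport ?_
  have hs : Function.support (fun x => inner ℂ (u x) (v x)) ⊆ C := by
    intro x hx
    by_contra hxC
    exact hx (by simp [huC x hxC])
  exact hC.closure_of_subset hs

variable (n F E μ)

/-- The inner product `⟨u, v⟩ = ∫ ⟨u(x), v(x)⟩ dμ(x)` of `L²(M; E)` on `C₀^∞(M; E)`. -/
@[reducible] def testCore [T2Space M] [BorelSpace M] [IsSmoothHermitianBundle n F E] [IsSmoothPositiveDensity n μ] :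
    PreInnerProductSpace.Core ℂ (TestSection n F E μ) where
  inner u v := ∫ x, inner ℂ (u x) (v x) ∂μ
  conj_inner_symm u v := by
    rw [← integral_conj]
    simp only [inner_conj_symm]
  re_inner_nonneg u := by
    have h := integral_re (TestSection.integrable_inner u u)
    rw [← h]
    exact integral_nonneg fun x => inner_self_nonneg
  add_left u v w := by
    rw [← integral_add (TestSection.integrable_inner u w) (TestSection.integrable_inner v w)]
    exact integral_congr_ae (Filter.Eventually.of_forall fun x => inner_add_left (u x) (v x) (w x))
  smul_left u v c := by
    rw [← integral_const_mul]
    exact integral_congr_ae (Filter.Eventually.of_forall fun x => inner_smul_left (u x) (v x) c)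

instance [T2Space M] [BorelSpace M] [IsSmoothHermitianBundle n F E] [IsSmoothPositiveDensity n μ] :
    SeminormedAddCommGroup (TestSection n F E μ) :=
  @InnerProductSpace.Core.toSeminormedAddCommGroup ℂ _ _ _ _ (testCore n F E μ)

instance [T2Space M] [BorelSpace M] [IsSmoothHermitianBundle n F E] [IsSmoothPositiveDensity n μ] :
    InnerProductSpace ℂ (TestSection n F E μ) :=
  InnerProductSpace.ofCore (testCore n F E μ)

/-- The Hilbert space `L²(M; E)`: the completion of `C₀^∞(M; E)` for the inner product
`∫ ⟨u(x), v(x)⟩ dμ(x)`. -/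
abbrev L2 [T2Space M] [BorelSpace M] [IsSmoothHermitianBundle n F E] [IsSmoothPositiveDensity n μ] : Type _ :=
  UniformSpace.Completion (TestSection n F E μ)

/-! ### Integral kernels -/

/-- `K ∈ C^∞(M × M; E ⊠ E*)`: the family of linear maps `K(x, y) : E_y → E_x`, read in local
trivializations of `E`, is smooth in `(x, y)`. -/
def IsSmoothKernel (K : ∀ x y : M, E y →L[ℂ] E x) : Prop :=
  ∀ x₀ y₀ : M, ContMDiffAt ((𝓡 n).prod (𝓡 n)) 𝓘(ℝ, F →L[ℂ] F) ∞
    (fun p : M × M =>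
      ContinuousLinearMap.inCoordinates F E F E y₀ p.2 x₀ p.1 (K p.1 p.2)) (x₀, y₀)

variable {E} in
/-- Both projections `M × M → M` are proper on the support of `K`. -/
def IsProperlySupported (K : ∀ x y : M, E y →L[ℂ] E x) : Prop :=
  ∀ C : Set M, IsCompact C →
    IsCompact (closure {p : M × M | K p.1 p.2 ≠ 0} ∩ Prod.fst ⁻¹' C) ∧
    IsCompact (closure {p : M × M | K p.1 p.2 ≠ 0} ∩ Prod.snd ⁻¹' C)

variable {n F E μ}

/-- `∫∫ ⟨v(x), K(x, y) u(y)⟩ dμ(y) dμ(x)`, the pairing of `v` with `K u`. -/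
def kernelPairing (K : ∀ x y : M, E y →L[ℂ] E x) (v u : TestSection n F E μ) : ℂ :=
  ∫ x, ∫ y, inner ℂ (v x) (K x y (u y)) ∂μ ∂μ

variable (n F μ) in
/-- The kernel `K` is non-negative: `∫∫ ⟨u(x), K(x, y) u(y)⟩ dμ(y) dμ(x) ≥ 0` (in particular, is
real) for all `u ∈ C₀^∞(M; E)`. -/
def IsNonnegKernel (K : ∀ x y : M, E y →L[ℂ] E x) : Prop :=
  ∀ u : TestSection n F E μ, 0 ≤ kernelPairing K u u

variable [T2Space M] [BorelSpace M] [IsSmoothHermitianBundle n F E] [IsSmoothPositiveDensity n μ]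

/-- The (possibly unbounded) operator `A` in `L²(M; E)` has integral kernel `K`: every
`u ∈ C₀^∞(M; E)` lies in the domain of `A`, and `A u` is given by `x ↦ ∫ K(x, y) u(y) dμ(y)`,
that is, `⟨v, A u⟩ = ∫∫ ⟨v(x), K(x, y) u(y)⟩ dμ(y) dμ(x)` for all `v ∈ C₀^∞(M; E)`. -/
def HasIntegralKernel (A : L2 n F E μ →ₗ.[ℂ] L2 n F E μ) (K : ∀ x y : M, E y →L[ℂ] E x) : Prop :=
  ∀ u : TestSection n F E μ, ∃ hu : (u : L2 n F E μ) ∈ A.domain,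
    ∀ v : TestSection n F E μ,
      inner ℂ (v : L2 n F E μ) (A ⟨(u : L2 n F E μ), hu⟩) = kernelPairing K v u

/-- `A` is a non-negative self-adjoint operator in `L²(M; E)` which extends the operator defined
by the kernel `K` on `C₀^∞(M; E)`. -/
structure IsNonnegSelfAdjointRealization (A : L2 n F E μ →ₗ.[ℂ] L2 n F E μ)
    (K : ∀ x y : M, E y →L[ℂ] E x) : Prop where
  isSelfAdjoint : IsSelfAdjoint A
  nonneg : ∀ w : A.domain, 0 ≤ inner ℂ (w : L2 n F E μ) (A w)
  hasIntegralKernel : HasIntegralKernel A K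

end Sections

/-! ### Unbounded operators and their inverse square roots -/

section InvSqrt

variable {H : Type*} [NormedAddCommGroup H] [InnerProductSpace ℂ H]

/-- The operator `id + A`, with the same domain as `A`. -/
def idAdd (A : H →ₗ.[ℂ] H) : H →ₗ.[ℂ] H := (LinearMap.id : H →ₗ[ℂ] H) +ᵥ A

/-- The everywhere defined bounded operator `S`, regarded as a possibly unbounded operator. -/
def ofBounded (S : H →L[ℂ] H) : H →ₗ.[ℂ] H := S.toLinearMap.toPMap ⊤

/-- The bounded operator `R` is the (two-sided) inverse of the possibly unbounded operator `B`. -/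
structure IsBoundedInverse (B : H →ₗ.[ℂ] H) (R : H →L[ℂ] H) : Prop where
  apply_inv : ∀ w : H, ∃ hw : R w ∈ B.domain, B ⟨R w, hw⟩ = w
  inv_apply : ∀ w : B.domain, R (B w) = w

/-- `T = B^{-1/2}` in the spectral calculus, for a self-adjoint operator `B` which is bounded below
by a positive constant: `B` has a bounded inverse, and `T` is the function `s ↦ √s` of the bounded
self-adjoint operator `B⁻¹`. -/
def IsInvSqrt [CompleteSpace H] (B : H →ₗ.[ℂ] H) (T : H →L[ℂ] H) : Prop :=
  ∃ R : H →L[ℂ] H, IsBoundedInverse B R ∧ T = cfc Real.sqrt R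

theorem IsBoundedInverse.unique {B : H →ₗ.[ℂ] H} {R R' : H →L[ℂ] H} (h : IsBoundedInverse B R)
    (h' : IsBoundedInverse B R') : R = R' := by
  ext w
  obtain ⟨hw, hBw⟩ := h'.apply_inv w
  have := h.inv_apply ⟨R' w, hw⟩
  rwa [hBw] at this

theorem IsInvSqrt.unique [CompleteSpace H] {B : H →ₗ.[ℂ] H} {T T' : H →L[ℂ] H} (h : IsInvSqrt B T)
    (h' : IsInvSqrt B T') : T = T' := by
  obtain ⟨R, hR, rfl⟩ := h
  obtain ⟨R', hR', rfl⟩ := h'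
  rw [hR.unique hR']

end InvSqrt

end SmoothKernel

end

set_option linter.unusedSectionVars false

noncomputable section

namespace SmoothKernel

open scoped Topology

/-! ### Non-negative self-adjoint operators and their resolvents -/

section Operators

variable {H : Type*} [NormedAddCommGroup H] [InnerProductSpace ℂ H]

/-! For `λ ≥ 0` one has `1 - (1 + λ)^(-1/2) = λ/2 - λ g(λ) λ` with `g` bounded on `[0, ∞)`. For
operators this becomes `id - T = K/2 - K S K` with `S` bounded, read as an identity of forms on
`C₀^∞(M; E)` (`exists_one_sub_sqrt_eq`). The term `K/2` has a smooth kernel already; splitting it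
off leaves a bounded operator with a factor `K` on both sides, so that it gets smoothed in both
variables.

Write `κ(y) η = K(·, y) η`. Since `K` is smooth and properly supported, `κ` is a smooth map with
values in `L²` (`contMDiffAt_kernelMap`), so `κ(x)* S κ(y)` is a smooth kernel for every bounded `S`
(`isSmoothKernel_sandwichKernel`), and it is the kernel of the form `⟨K v, S K u⟩`
(`inner_kernelOp_apply`). A self-adjoint extension enters only through its resolvent `R = (id +
K)⁻¹` and the identity `R (u + K u) = u` on test sections, so all extensions are treated alike.

An extension exists by Friedrichs' method. If `J` maps the completion for the form `⟨u, v + K v⟩` to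
`L²`, then `R = J J*` is the resolvent at `-1`, and the extension is `R⁻¹ - id`. Injectivity of `J`
is not needed: the range of `R` contains the test sections, hence is dense, and a symmetric operator
with dense range is injective. -/

/-- A non-negative sesquilinear form is hermitian. -/
theorem conj_inner_of_nonneg {D : Type*} [AddCommGroup D] [Module ℂ D] {ι κ : D →ₗ[ℂ] H}
    (h : ∀ u, 0 ≤ inner ℂ (ι u) (κ u)) (u v : D) :
    (starRingEnd ℂ) (inner ℂ (ι v) (κ u)) = inner ℂ (ι u) (κ v) := by
  have him : ∀ u, (inner ℂ (ι u) (κ u)).im = 0 := fun u => (Complex.nonneg_iff.1 (h u)).2.symm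
  -- Polarization: reality of the form at `u + v` compares imaginary parts, at `u + i v` real parts.
  have h1 := him (u + v)
  have h2 := him (u + Complex.I • v)
  simp only [map_add, map_smul, inner_add_left, inner_add_right, inner_smul_left, inner_smul_right,
    Complex.add_im, Complex.mul_im, Complex.add_re, Complex.mul_re, Complex.conj_I,
    Complex.neg_re, Complex.neg_im,
    Complex.I_re, Complex.I_im, him] at h1 h2
  apply Complex.ext
  · simp only [Complex.conj_re]; linarith
  · simp only [Complex.conj_im]; linarith

/-- The form domain of a non-negative operator `κ`, defined on the dense subspace `ι D`, gives the
resolvent at `-1` of its Friedrichs extension. -/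
theorem exists_resolvent_of_nonneg [CompleteSpace H] {D : Type*} [AddCommGroup D] [Module ℂ D]
    {ι κ : D →ₗ[ℂ] H} (h : ∀ u, 0 ≤ inner ℂ (ι u) (κ u)) :
    ∃ R : H →L[ℂ] H, (∀ f g, inner ℂ (R f) g = inner ℂ f (R g)) ∧
      (∀ f, 0 ≤ inner ℂ (R f) (f - R f)) ∧ ∀ u, R (ι u + κ u) = ι u := by
  -- The form inner product. It is only semidefinite, since `ι` need not be injective.
  let core : PreInnerProductSpace.Core ℂ D :=
    { inner := fun u v => inner ℂ (ι u) (ι v + κ v)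
      conj_inner_symm := fun u v => by
        rw [inner_add_right, inner_add_right, map_add, inner_conj_symm, conj_inner_of_nonneg h]
      re_inner_nonneg := fun u => by
        rw [inner_add_right, map_add]
        exact add_nonneg inner_self_nonneg (Complex.nonneg_iff.1 (h u)).1
      add_left := fun u v w => by rw [map_add, inner_add_left]
      smul_left := fun u v c => by rw [map_smul, inner_smul_left] }
  let _ : SeminormedAddCommGroup D :=
    @InnerProductSpace.Core.toSeminormedAddCommGroup ℂ _ _ _ _ core
  let _ : InnerProductSpace ℂ D := InnerProductSpace.ofCore core
  have hinner : ∀ u v : D, inner ℂ u v = inner ℂ (ι u) (ι v + κ v) := fun _ _ => rfl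
  have hle : ∀ u, ‖ι u‖ ≤ 1 * ‖u‖ := fun u => by
    rw [one_mul, ← sq_le_sq₀ (norm_nonneg _) (norm_nonneg _), ← inner_self_eq_norm_sq (𝕜 := ℂ),
      ← inner_self_eq_norm_sq (𝕜 := ℂ), hinner, inner_add_right, map_add]
    exact le_add_of_nonneg_right (Complex.nonneg_iff.1 (h u)).1
  let e : D →L[ℂ] UniformSpace.Completion D := UniformSpace.Completion.toComplL
  let J : UniformSpace.Completion D →L[ℂ] H := (ι.mkContinuous 1 hle).extend e
  have hed : DenseRange e := UniformSpace.Completion.denseRange_coe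
  have hJ : ∀ u : D, J (e u) = ι u := fun u =>
    ContinuousLinearMap.extend_eq (ι.mkContinuous 1 hle) hed
      (UniformSpace.Completion.isUniformInducing_coe D) u
  have hR : ∀ f, inner ℂ (J (J.adjoint f)) f = inner ℂ (J.adjoint f) (J.adjoint f) := fun f => by
    rw [← ContinuousLinearMap.adjoint_inner_right]
  have hJle : ‖J‖ ≤ 1 := by
    refine J.opNorm_le_bound zero_le_one fun x => ?_
    induction x using UniformSpace.Completion.induction_on with
    | hp => exact isClosed_le (by fun_prop) (by fun_prop)
    | ih u =>
      rw [show ((u : D) : UniformSpace.Completion D) = e u from rfl, hJ,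
        show ‖e u‖ = ‖u‖ from UniformSpace.Completion.norm_coe u]
      exact hle u
  -- `J* f` is the Riesz representative of `f` in the form space, so `J J* f` solves `w + κ w = f`
  -- weakly. Positivity is `‖J J* f‖ ≤ ‖J* f‖`, and the last claim follows from `J* (ι u + κ u) = e
  -- u`.
  refine ⟨J ∘L J.adjoint, fun f g => ?_, fun f => ?_, fun u => ?_⟩
  · rw [ContinuousLinearMap.comp_apply, ContinuousLinearMap.comp_apply,
      ← ContinuousLinearMap.adjoint_inner_left J, ContinuousLinearMap.adjoint_inner_right]
  · rw [ContinuousLinearMap.comp_apply, inner_sub_right, hR, inner_self_eq_norm_sq_to_K,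
      inner_self_eq_norm_sq_to_K, sub_nonneg]
    norm_cast
    refine pow_le_pow_left₀ (norm_nonneg _) ?_ 2
    simpa using J.le_of_opNorm_le hJle (J.adjoint f)
  · rw [ContinuousLinearMap.comp_apply, ← hJ u]
    congr 1
    refine ext_inner_right ℂ fun y => ?_
    induction y using UniformSpace.Completion.induction_on with
    | hp => exact isClosed_eq (by fun_prop) (by fun_prop)
    | ih v =>
      have h1 : ((v : D) : UniformSpace.Completion D) = e v := rfl
      have h2 : inner ℂ (e u) (e v) = inner ℂ u v := UniformSpace.Completion.inner_coe u v
      rw [h1, ContinuousLinearMap.adjoint_inner_left, hJ, hJ, h2, ← inner_conj_symm u v, hinner v u,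
        inner_conj_symm]

/-- The inverse of an injective symmetric bounded operator, shifted by `-id`, is self-adjoint. -/
theorem exists_isSelfAdjoint_of_resolvent [CompleteSpace H] {R : H →L[ℂ] H}
    (hsymm : ∀ f g, inner ℂ (R f) g = inner ℂ f (R g)) (hR : DenseRange R) :
    ∃ A : H →ₗ.[ℂ] H, IsSelfAdjoint A ∧ (∀ w : A.domain, ∃ f, (w : H) = R f ∧ A w = f - R f) ∧
      ∀ f, ∃ hf : R f ∈ A.domain, A ⟨R f, hf⟩ = f - R f := by
  have hinj : ∀ f, R f = 0 → f = 0 := fun f hf => by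
    refine ext_inner_left ℂ fun v => ?_
    refine hR.induction_on v (isClosed_eq (by fun_prop) (by fun_prop)) fun w => ?_
    rw [hsymm, hf, inner_zero_right, inner_zero_right]
  -- The graph of `R⁻¹ - id`, parametrized by `f ↦ (R f, f - R f)`; it is single-valued because `R`
  -- is injective.
  let g : Submodule ℂ (H × H) :=
    LinearMap.range ((R : H →ₗ[ℂ] H).prod (LinearMap.id - (R : H →ₗ[ℂ] H)))
  have hg : ∀ x : H × H, x ∈ g → x.1 = 0 → x.2 = 0 := by
    rintro x ⟨f, rfl⟩ hx
    have := hinj f hx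
    simp [this]
  let A : H →ₗ.[ℂ] H := g.toLinearPMap
  have hgraph : A.graph = g := Submodule.toLinearPMap_graph_eq g hg
  have hA : ∀ w : A.domain, ∃ f, (w : H) = R f ∧ A w = f - R f := fun w => by
    have : ((w : H), A w) ∈ g := hgraph ▸ A.mem_graph w
    obtain ⟨f, hf⟩ := this
    exact ⟨f, (congrArg Prod.fst hf).symm, (congrArg Prod.snd hf).symm⟩
  have hA' : ∀ f, ∃ hf : R f ∈ A.domain, A ⟨R f, hf⟩ = f - R f := fun f => by
    have : (R f, f - R f) ∈ A.graph := hgraph ▸ ⟨f, rfl⟩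
    refine ⟨LinearPMap.mem_domain_of_mem_graph this, ?_⟩
    exact ((LinearPMap.image_iff _).2 this).symm
  have hdense : Dense (A.domain : Set H) := by
    refine hR.mono ?_
    rintro _ ⟨f, rfl⟩
    exact (hA' f).1
  refine ⟨A, ?_, hA, hA'⟩
  rw [LinearPMap.isSelfAdjoint_def]
  have hformal : A.IsFormalAdjoint A := fun x y => by
    obtain ⟨f, hf, hAf⟩ := hA x
    obtain ⟨g, hg, hAg⟩ := hA y
    rw [hAf, hAg, hf, hg, inner_sub_left, inner_sub_right, hsymm, hsymm]
  refine (LinearPMap.eq_of_le_of_domain_eq (hformal.le_adjoint hdense)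
    (le_antisymm (hformal.le_adjoint hdense).1 fun y hy => ?_)).symm
  -- For `y` in the domain of `A*`, the vector `R (y + A* y)` is in the domain of `A`, and pairing
  -- with an arbitrary `z` shows that it equals `y`.
  set f := (y : H) + A.adjoint ⟨y, hy⟩ with hf
  obtain ⟨hRf, -⟩ := hA' f
  suffices R f = y by rwa [← this]
  refine ext_inner_right ℂ fun z => ?_
  obtain ⟨hz, hAz⟩ := hA' z
  have := A.adjoint_isFormalAdjoint hdense ⟨y, hy⟩ ⟨R z, hz⟩
  rw [hAz] at this
  rw [hsymm, hf, inner_add_left, this, inner_sub_right]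
  ring

/-- A densely defined non-negative operator has a non-negative self-adjoint extension. -/
theorem exists_isSelfAdjoint_extension [CompleteSpace H] {D : Type*} [AddCommGroup D] [Module ℂ D]
    {ι κ : D →ₗ[ℂ] H} (hι : DenseRange ι) (h : ∀ u, 0 ≤ inner ℂ (ι u) (κ u)) :
    ∃ A : H →ₗ.[ℂ] H, IsSelfAdjoint A ∧ (∀ w : A.domain, 0 ≤ inner ℂ (w : H) (A w)) ∧
      ∀ u, ∃ hu : ι u ∈ A.domain, A ⟨ι u, hu⟩ = κ u := by
  obtain ⟨R, hsymm, hpos, hRι⟩ := exists_resolvent_of_nonneg h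
  have hR : DenseRange R := hι.mono (by rintro _ ⟨u, rfl⟩; exact ⟨_, hRι u⟩)
  obtain ⟨A, hA, h1, h2⟩ := exists_isSelfAdjoint_of_resolvent hsymm hR
  refine ⟨A, hA, fun w => ?_, fun u => ?_⟩
  · obtain ⟨f, hf, hAf⟩ := h1 w
    rw [hf, hAf]
    exact hpos f
  · obtain ⟨hf, hAf⟩ := h2 (ι u + κ u)
    simp only [hRι] at hf hAf
    exact ⟨hf, by simpa using hAf⟩

/-- `id + A` has a bounded inverse if `A` is self-adjoint and non-negative. -/
theorem exists_isBoundedInverse [CompleteSpace H] {A : H →ₗ.[ℂ] H} (hA : IsSelfAdjoint A)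
    (hpos : ∀ w : A.domain, 0 ≤ inner ℂ (w : H) (A w)) :
    ∃ R : H →L[ℂ] H, IsBoundedInverse (idAdd A) R ∧ 0 ≤ R ∧ R ≤ 1 := by
  have hdense := hA.dense_domain
  have hformal : A.IsFormalAdjoint A := by
    have := A.adjoint_isFormalAdjoint hdense
    rwa [LinearPMap.isSelfAdjoint_def.1 hA] at this
  have hbound : ∀ w : A.domain, ‖(w : H)‖ ≤ ‖(w : H) + A w‖ := fun w => by
    have h1 : ‖(w : H)‖ ^ 2 ≤ ‖(w : H)‖ * ‖(w : H) + A w‖ := by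
      calc ‖(w : H)‖ ^ 2 = RCLike.re (inner ℂ (w : H) (w : H)) :=
            (inner_self_eq_norm_sq (𝕜 := ℂ) _).symm
        _ ≤ RCLike.re (inner ℂ (w : H) ((w : H) + A w)) := by
            rw [inner_add_right, map_add]
            exact le_add_of_nonneg_right (Complex.nonneg_iff.1 (hpos w)).1
        _ ≤ _ := re_inner_le_norm _ _
    by_contra! hlt
    nlinarith [norm_nonneg ((w : H) + A w)]
  let S : Submodule ℂ H := LinearMap.range (idAdd A).toFun
  -- A self-adjoint `A` has a closed, hence complete, graph, and the range is the image of the graph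
  -- under `(w, A w) ↦ w + A w`, which is bounded below.
  have hclosed : IsClosed (S : Set H) := by
    have hAcl : IsClosed (A.graph : Set (H × H)) := hA.isClosed
    have hset : (S : Set H) = Set.range (fun p : A.graph => p.1.1 + p.1.2) := by
      ext f
      constructor
      · rintro ⟨w, rfl⟩
        exact ⟨⟨_, A.mem_graph w⟩, rfl⟩
      · rintro ⟨⟨⟨w, w'⟩, hw⟩, rfl⟩
        obtain ⟨y, rfl, rfl⟩ := (LinearPMap.mem_graph_iff _).1 hw
        exact ⟨y, rfl⟩
    rw [hset]
    have : CompleteSpace A.graph := hAcl.completeSpace_coe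
    -- The constant is 2 because `‖w‖ ≤ ‖w + A w‖` gives `‖A w‖ ≤ 2 ‖w + A w‖`, and the graph
    -- carries the maximum norm.
    refine AntilipschitzWith.isClosed_range (K := 2) ?_ ?_
    · refine AntilipschitzWith.of_le_mul_dist fun p q => ?_
      obtain ⟨y, hy1, hy2⟩ := (LinearPMap.mem_graph_iff _).1 (p - q).2
      have hb := hbound y
      rw [hy1, hy2] at hb
      rw [dist_eq_norm, dist_eq_norm]
      have e : (p.1.1 + p.1.2 - (q.1.1 + q.1.2)) = (p - q).1.1 + (p - q).1.2 := by
        simp only [Submodule.coe_sub, Prod.fst_sub, Prod.snd_sub]; abel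
      rw [e, ← Submodule.norm_coe, Prod.norm_def]
      refine max_le ?_ ?_
      · refine hb.trans ?_
        exact le_mul_of_one_le_left (norm_nonneg _) (by norm_num)
      · have := norm_sub_le ((p - q).1.1 + (p - q).1.2) (p - q).1.1
        rw [add_sub_cancel_left] at this
        norm_num
        norm_num at this hb
        linarith
    · have : LipschitzWith 2 (fun p : A.graph => p.1.1 + p.1.2) := by
        have h1 : LipschitzWith 1 (fun p : A.graph => p.1.1) :=
          (LipschitzWith.prod_fst.comp (LipschitzWith.subtype_val _)).weaken (by simp)
        have h2 : LipschitzWith 1 (fun p : A.graph => p.1.2) :=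
          (LipschitzWith.prod_snd.comp (LipschitzWith.subtype_val _)).weaken (by simp)
        have := h1.add h2
        rwa [one_add_one_eq_two] at this
      exact this.uniformContinuous
  have hker : ∀ w : A.domain, (w : H) + A w = 0 → (w : H) = 0 := fun w hw => by
    have := hbound w
    rw [hw, norm_zero] at this
    exact norm_le_zero_iff.1 this
  -- A vector `y` orthogonal to the range satisfies `A* y = -y`. As `A* = A`, it lies in the kernel
  -- of `id + A`, which is zero.
  have htop : S = ⊤ := by
    have : CompleteSpace S := hclosed.completeSpace_coe
    rw [← Submodule.orthogonal_eq_bot_iff, Submodule.eq_bot_iff]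
    intro y hy
    have hy' : ∀ x : A.domain, inner ℂ (-y) (x : H) = inner ℂ y (A x) := fun x => by
      have := (Submodule.mem_orthogonal' _ _).1 hy _ ⟨x, rfl⟩
      change inner ℂ y ((x : H) + A x) = 0 at this
      rw [inner_add_right] at this
      rw [inner_neg_left]
      linear_combination -this
    have hdom : y ∈ A.adjoint.domain := A.mem_adjoint_domain_of_exists y ⟨-y, hy'⟩
    have hval := LinearPMap.adjoint_apply_eq hdense ⟨y, hdom⟩ hy'
    rw [LinearPMap.isSelfAdjoint_def] at hA
    have hmem : (y, -y) ∈ A.graph := by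
      have := A.adjoint.mem_graph ⟨y, hdom⟩
      rw [hval] at this
      exact hA ▸ this
    obtain ⟨w, hw1, hw2⟩ := (LinearPMap.mem_graph_iff _).1 hmem
    have := hker w (by rw [hw1, hw2, add_neg_cancel])
    simpa only [hw1] using this
  have hinj : Function.Injective (idAdd A).toFun :=
    (injective_iff_map_eq_zero _).2 fun w hw => Subtype.ext (hker w hw)
  let e : A.domain ≃ₗ[ℂ] H :=
    LinearEquiv.ofBijective (idAdd A).toFun ⟨hinj, LinearMap.range_eq_top.1 htop⟩
  have he : ∀ w : A.domain, e w = (w : H) + A w := fun _ => rfl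
  let R : H →L[ℂ] H := (A.domain.subtype ∘ₗ (e.symm : H →ₗ[ℂ] A.domain)).mkContinuous 1
    fun f => by
      have := hbound (e.symm f)
      rw [← he, e.apply_symm_apply] at this
      simpa using this
  have hRe : ∀ f, R f = (e.symm f : H) := fun _ => rfl
  have hsum : ∀ f, (e.symm f : H) + A (e.symm f) = f := fun f => by
    rw [← he, e.apply_symm_apply]
  have hsymm : (R : H →ₗ[ℂ] H).IsSymmetric := fun f g => by
    change inner ℂ (R f) g = inner ℂ f (R g)
    rw [hRe, hRe]
    conv_lhs => rw [← hsum g]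
    conv_rhs => rw [← hsum f]
    rw [inner_add_left, inner_add_right, hformal]
  refine ⟨R, ⟨fun w => ⟨(e.symm w).2, hsum w⟩, fun w => ?_⟩, ?_, ?_⟩
  · exact congrArg Subtype.val (e.symm_apply_apply w)
  · rw [ContinuousLinearMap.nonneg_iff_isPositive]
    refine ⟨hsymm, fun f => ?_⟩
    rw [ContinuousLinearMap.reApplyInnerSelf_apply]
    nth_rw 2 [← hsum f]
    rw [hRe, inner_add_right, map_add]
    exact add_nonneg inner_self_nonneg (Complex.nonneg_iff.1 (hpos _)).1
  · rw [ContinuousLinearMap.le_def]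
    refine ⟨fun f g => ?_, fun f => ?_⟩
    · have := hsymm f g
      simp only [ContinuousLinearMap.coe_coe] at this
      simp [inner_sub_left, inner_sub_right, this]
    · rw [ContinuousLinearMap.reApplyInnerSelf_apply, sub_apply,
        one_apply_eq_self]
      -- With `w = R f` and `f = w + A w`, the form of `1 - R` at `f` is `re ⟨A w, w⟩ + ‖A w‖²`.
      have h1 : f - R f = A (e.symm f) := by
        rw [hRe]; nth_rw 1 [← hsum f]; rw [add_sub_cancel_left]
      rw [h1]
      nth_rw 2 [← hsum f]
      rw [inner_add_right, map_add]
      refine add_nonneg ?_ inner_self_nonneg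
      rw [inner_re_symm]
      exact (Complex.nonneg_iff.1 (hpos _)).1

/-! ### The square root of the resolvent -/

/-- If `T = √R` with `0 ≤ R ≤ 1`, then `0 ≤ 1 - T`, and on the image of `R` the operator `1 - T` is
a quadratic expression in `A = R⁻¹ - 1`, up to a bounded operator `S`. -/
theorem exists_one_sub_sqrt_eq [CompleteSpace H] {R : H →L[ℂ] H} (h0 : 0 ≤ R) (h1 : R ≤ 1) :
    (1 - cfc Real.sqrt R).IsPositive ∧
      ∃ S : H →L[ℂ] H, ∀ u v a b : H, R (u + a) = u → R (v + b) = v →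
        inner ℂ v ((1 - cfc Real.sqrt R) u) = 2⁻¹ * inner ℂ v a - inner ℂ b (S a) := by
  have hsa : IsSelfAdjoint R := .of_nonneg h0
  set T := cfc Real.sqrt R with hT
  have hT0 : 0 ≤ T := cfc_nonneg fun x _ => Real.sqrt_nonneg x
  have hT1 : T ≤ 1 := by
    refine cfc_le_one _ _ fun x hx => ?_
    rw [Real.sqrt_le_one]
    exact (le_algebraMap_iff_spectrum_le (r := (1 : ℝ)) (a := R)).1 (by simpa using h1) x hx
  have hTT : T * T = R := by
    rw [hT, ← cfc_mul Real.sqrt Real.sqrt R]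
    conv_rhs => rw [← cfc_id ℝ R]
    refine cfc_congr fun x hx => ?_
    exact Real.mul_self_sqrt (spectrum_nonneg_of_nonneg h0 hx)
  refine ⟨(ContinuousLinearMap.le_def _ _).1 hT1, ?_⟩
  have hunit : IsUnit (1 + T) := CStarAlgebra.isUnit_of_le (1 : H →L[ℂ] H) (by simpa using hT0)
  obtain ⟨V, hV⟩ := hunit
  set U : H →L[ℂ] H := ↑V⁻¹ with hU
  have hU1 : (1 + T) * U = 1 := by rw [← hV]; exact V.mul_inv
  have hU2 : U * (1 + T) = 1 := by rw [← hV]; exact V.inv_mul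
  have hTU : T * U = 1 - U := by rw [eq_sub_iff_add_eq', ← hU1, add_mul, one_mul]
  have hUT : U * T = 1 - U := by rw [eq_sub_iff_add_eq', ← hU2, mul_add, mul_one]
  have hRU : R * U = T - 1 + U := by rw [← hTT, mul_assoc, hTU, mul_sub, mul_one, hTU]; abel
  have hUR : U * R = T - 1 + U := by rw [← hTT, ← mul_assoc, hUT, sub_mul, one_mul, hUT]; abel
  have hsymm : ∀ f g, inner ℂ (R f) g = inner ℂ f (R g) := fun f g => by
    rw [← ContinuousLinearMap.adjoint_inner_right, ← ContinuousLinearMap.star_eq_adjoint,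
      hsa.star_eq]
  -- Here `U = (1 + T)⁻¹`. Formally `C = (1 - R)⁻¹ (1/2 - U R)`; in a scalar `t` the numerator is
  -- `(1 - t)(1 + 2t) / (2(1 + t))`, so the factor `1 - t` of `1 - t²` cancels and `C = U - U²/2`
  -- remains bounded.
  obtain ⟨C, hC⟩ : ∃ C, C - R * C = (2⁻¹ : ℂ) • 1 - U * R := by
    refine ⟨U - (2⁻¹ : ℂ) • (U * U), ?_⟩
    have : R * (U * U) = 1 - U - U + U * U := by
      rw [← mul_assoc, hRU, add_mul, sub_mul, hTU, one_mul]
    rw [mul_sub, mul_smul_comm, this, hRU, hUR]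
    module
  refine ⟨R * C, fun u v a b hu hv => ?_⟩
  have hb : R b = v - R v := by rw [map_add] at hv; rw [eq_sub_iff_add_eq', hv]
  have ha : R a = u - R u := by rw [map_add] at hu; rw [eq_sub_iff_add_eq', hu]
  have h5 : U - U * R = 1 - T := by rw [hUR]; abel
  -- Moving `R` onto `b` trades the unbounded `b = A v` for `R b = v - R v`.
  have h6 : inner ℂ b ((R * C) a) = inner ℂ v ((C - R * C) a) := by
    rw [mul_apply_eq_comp, ← hsymm, hb, sub_apply, inner_sub_left, inner_sub_right,
      mul_apply_eq_comp, hsymm]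
  have h7 : U (R a) = (1 - T) u := by
    rw [← h5, ha, map_sub, sub_apply, mul_apply_eq_comp]
  have h8 : ((2⁻¹ : ℂ) • 1 - U * R) a = (2⁻¹ : ℂ) • a - U (R a) := rfl
  rw [h6, hC, h8, h7, inner_sub_right, inner_smul_right]
  ring

end Operators

section Geometry

variable {n : ℕ} {M : Type*} [TopologicalSpace M] [ChartedSpace (EuclideanSpace ℝ (Fin n)) M]
  {F : Type*} [NormedAddCommGroup F] [NormedSpace ℂ F]
  {E : M → Type*} [TopologicalSpace (TotalSpace F E)] [∀ x, NormedAddCommGroup (E x)]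
  [∀ x, InnerProductSpace ℂ (E x)] [FiberBundle F E] [VectorBundle ℂ F E] [VectorBundle ℝ F E]

/-! ### Smooth sections along maps -/

section Along

variable {EN : Type*} [NormedAddCommGroup EN] [NormedSpace ℝ EN] {HN : Type*} [TopologicalSpace HN]
  {I : ModelWithCorners ℝ EN HN} {N : Type*} [TopologicalSpace N] [ChartedSpace HN N]
  {b : N → M} {s t : ∀ p, E (b p)} {p₀ : N}

theorem contMDiffAt_complex_smul
    (hs : ContMDiffAt I ((𝓡 n).prod 𝓘(ℝ, F)) ∞ (fun p => TotalSpace.mk' F (b p) (s p)) p₀) (c : ℂ) :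
    ContMDiffAt I ((𝓡 n).prod 𝓘(ℝ, F)) ∞ (fun p => TotalSpace.mk' F (b p) (c • s p)) p₀ := by
  rw [contMDiffAt_totalSpace] at hs ⊢
  refine ⟨hs.1, ?_⟩
  have hL : ContDiff ℝ ∞ (fun v : F => c • v) := contDiff_const_smul c
  refine (hL.contMDiff.contMDiffAt.comp p₀ hs.2).congr_of_eventuallyEq ?_
  filter_upwards [hs.1.continuousAt.preimage_mem_nhds
    ((trivializationAt F E (b p₀)).open_baseSet.mem_nhds
      (FiberBundle.mem_baseSet_trivializationAt' (b p₀)))] with p hp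
  exact ((trivializationAt F E (b p₀)).linear ℂ hp).2 c (s p)

theorem contMDiffAt_re_inner [IsSmoothHermitianBundle n F E]
    (hs : ContMDiffAt I ((𝓡 n).prod 𝓘(ℝ, F)) ∞ (fun p => TotalSpace.mk' F (b p) (s p)) p₀)
    (ht : ContMDiffAt I ((𝓡 n).prod 𝓘(ℝ, F)) ∞ (fun p => TotalSpace.mk' F (b p) (t p)) p₀) :
    ContMDiffAt I 𝓘(ℝ) ∞ (fun p => (inner ℂ (s p) (t p)).re) p₀ := by
  let _ : ∀ x, InnerProductSpace ℝ (E x) := fun _ => InnerProductSpace.complexToReal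
  have : IsContMDiffRiemannianBundle (𝓡 n) ∞ F E :=
    IsSmoothHermitianBundle.isContMDiffRiemannianBundle
  exact ContMDiffAt.inner_bundle hs ht

/-- Smoothness of the metric concerns its real part only; the imaginary part of `⟨s, t⟩` is the real
part of `⟨i s, t⟩`. -/
theorem continuousAt_inner [IsSmoothHermitianBundle n F E]
    (hs : ContMDiffAt I ((𝓡 n).prod 𝓘(ℝ, F)) ∞ (fun p => TotalSpace.mk' F (b p) (s p)) p₀)
    (ht : ContMDiffAt I ((𝓡 n).prod 𝓘(ℝ, F)) ∞ (fun p => TotalSpace.mk' F (b p) (t p)) p₀) :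
    ContinuousAt (fun p => inner ℂ (s p) (t p)) p₀ := by
  have hre := (contMDiffAt_re_inner hs ht).continuousAt
  have him := (contMDiffAt_re_inner (contMDiffAt_complex_smul hs Complex.I) ht).continuousAt
  have : (fun p => inner ℂ (s p) (t p)) = fun p =>
      ((inner ℂ (s p) (t p)).re : ℂ) + ((inner ℂ (Complex.I • s p) (t p)).re : ℂ) * Complex.I := by
    funext p
    rw [inner_smul_left]
    apply Complex.ext <;> simp
  rw [this]
  fun_prop

/-- A smooth kernel maps a smooth section along a map to a smooth section. -/
theorem IsSmoothKernel.contMDiffAt_apply {K : ∀ x y : M, E y →L[ℂ] E x}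
    (hK : IsSmoothKernel n F E K) {a : N → M} (ha : ContMDiffAt I (𝓡 n) ∞ a p₀)
    (hs : ContMDiffAt I ((𝓡 n).prod 𝓘(ℝ, F)) ∞ (fun p => TotalSpace.mk' F (b p) (s p)) p₀) :
    ContMDiffAt I ((𝓡 n).prod 𝓘(ℝ, F)) ∞
      (fun p => TotalSpace.mk' F (a p) (K (a p) (b p) (s p))) p₀ := by
  rw [contMDiffAt_totalSpace] at hs ⊢
  refine ⟨ha, ?_⟩
  have hab : ContMDiffAt I ((𝓡 n).prod (𝓡 n)) ∞ (fun p => (a p, b p)) p₀ := ha.prodMk hs.1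
  have h1 := (hK (a p₀) (b p₀)).comp p₀ hab
  have hB : ContDiff ℝ ∞ (fun q : (F →L[ℂ] F) × F => q.1 q.2) :=
    (isBoundedBilinearMap_apply (𝕜 := ℂ)).contDiff.restrict_scalars ℝ
  refine (hB.contMDiff.contMDiffAt.comp p₀ (h1.prodMk_space hs.2)).congr_of_eventuallyEq ?_
  filter_upwards [hs.1.continuousAt.preimage_mem_nhds
    ((trivializationAt F E (b p₀)).open_baseSet.mem_nhds
      (FiberBundle.mem_baseSet_trivializationAt' (b p₀))), ha.continuousAt.preimage_mem_nhds
    ((trivializationAt F E (a p₀)).open_baseSet.mem_nhds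
      (FiberBundle.mem_baseSet_trivializationAt' (a p₀)))] with p hp hp'
  simp only [Function.comp_apply]
  rw [ContinuousLinearMap.inCoordinates_eq hp hp']
  have : (trivializationAt F E (b p₀)).symm (b p) (trivializationAt F E (b p₀) ⟨b p, s p⟩).2 = s p :=
    (trivializationAt F E (b p₀)).symm_apply_apply_mk hp (s p)
  simp [this]

end Along

/-! ### Smooth families of sections -/

section Families

variable {P : Type*} [NormedAddCommGroup P] [NormedSpace ℝ P]

variable (n F) in
/-- The sections `φ z` depend smoothly on the parameter `z ∈ V` and vanish outside `C`. -/
structure IsSmoothFamily (V : Set P) (C : Set M) (φ : P → ∀ x, E x) : Prop where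
  smooth : ∀ z ∈ V, ∀ x, ContMDiffAt (𝓘(ℝ, P).prod (𝓡 n)) ((𝓡 n).prod 𝓘(ℝ, F)) ∞
    (fun p : P × M => TotalSpace.mk' F p.2 (φ p.1 p.2)) (z, x)
  eq_zero : ∀ z ∈ V, ∀ x ∉ C, φ z x = 0

variable {V : Set P} {C : Set M} {φ : P → ∀ x, E x}

theorem IsSmoothFamily.mem_testSections (h : IsSmoothFamily n F V C φ) (hC : IsCompact C) {z : P}
    (hz : z ∈ V) : φ z ∈ testSections n F E :=
  ⟨fun x => (h.smooth z hz x).comp (f := fun x : M => (z, x)) x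
    (contMDiffAt_const.prodMk contMDiffAt_id), C, hC, h.eq_zero z hz⟩

theorem IsSmoothFamily.differentiableAt (h : IsSmoothFamily n F V C φ) {z : P} (hz : z ∈ V) (x : M) :
    DifferentiableAt ℝ (fun z => φ z x) z := by
  have hx := FiberBundle.mem_baseSet_trivializationAt' (F := F) (E := E) x
  have h1 := (contMDiffAt_totalSpace.1 (h.smooth z hz x)).2
  have h2 := h1.comp (f := fun z : P => (z, x)) z (contMDiffAt_id.prodMk contMDiffAt_const)
  have h3 := h2.contDiffAt.differentiableAt (by simp)
  rw [← ((trivializationAt F E x).continuousLinearEquivAt ℝ x hx).comp_differentiableAt_iff]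
  exact h3

/-- The derivative of a smooth family with respect to the parameter is a smooth family. -/
theorem IsSmoothFamily.fderiv [IsManifold (𝓡 n) ∞ M] (h : IsSmoothFamily n F V C φ) (hV : IsOpen V)
    (v : P) :
    IsSmoothFamily n F V C (fun z x => fderiv ℝ (fun z => φ z x) z v) := by
  refine ⟨fun z hz x => ?_, fun z hz x hx => ?_⟩
  · rw [contMDiffAt_totalSpace]
    refine ⟨contMDiffAt_snd, ?_⟩
    set e := trivializationAt F E x with he
    have h1 := (contMDiffAt_totalSpace.1 (h.smooth z hz x)).2
    -- The variable `w` of differentiation is separated from the base point `p`, and set to `p.1`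
    -- only after differentiating.
    have h2 : ContMDiffAt ((𝓘(ℝ, P).prod (𝓡 n)).prod 𝓘(ℝ, P)) 𝓘(ℝ, F) ∞
        (Function.uncurry (fun (p : P × M) (w : P) => (e (TotalSpace.mk' F p.2 (φ w p.2))).2))
        ((z, x), z) :=
      h1.comp (f := fun q : (P × M) × P => (q.2, q.1.2)) ((z, x), z)
        (contMDiffAt_snd.prodMk (contMDiffAt_fst.snd))
    have h3 : ContMDiffAt (𝓘(ℝ, P).prod (𝓡 n)) 𝓘(ℝ, P →L[ℝ] F) ∞ (fun p : P × M =>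
        _root_.fderiv ℝ (fun w => (e (TotalSpace.mk' F p.2 (φ w p.2))).2) p.1) (z, x) := by
      have := ContMDiffAt.mfderiv (m := ∞) _ (fun p : P × M => p.1) h2 contMDiffAt_fst (by simp)
      refine this.congr_of_eventuallyEq (Filter.Eventually.of_forall fun p => ?_)
      refine Eq.trans ?_ (congrFun (inTangentCoordinates_model_space (I := 𝓘(ℝ, P))
        (I' := 𝓘(ℝ, F)) _ _ _ (z, x)) p).symm
      exact mfderiv_eq_fderiv.symm
    have h4 := h3.clm_apply (contMDiffAt_const (c := v))
    refine h4.congr_of_eventuallyEq ?_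
    have hx := FiberBundle.mem_baseSet_trivializationAt' (F := F) (E := E) x
    filter_upwards [(hV.prod e.open_baseSet).mem_nhds ⟨hz, hx⟩] with p hp
    -- For fixed `x` the family moves inside one fibre, where the trivialization is linear and
    -- commutes with the derivative.
    have := (((e.continuousLinearEquivAt ℝ p.2 hp.2).hasFDerivAt).comp p.1
      (h.differentiableAt hp.1 p.2).hasFDerivAt).fderiv
    exact (congrArg (fun L : P →L[ℝ] F => L v) this).symm
  · have : (fun z => φ z x) =ᶠ[𝓝 z] fun _ => 0 := by
      filter_upwards [hV.mem_nhds hz] with w hw using h.eq_zero w hw x hx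
    rw [this.fderiv_eq]
    simp

/-- Joint continuity gives the bound near each point of `C`, compactness of `C` makes it uniform in
`x`, and off `C` both sections vanish. -/
theorem IsSmoothFamily.eventually_norm_sub_le [IsSmoothHermitianBundle n F E]
    (h : IsSmoothFamily n F V C φ) (hV : IsOpen V) (hC : IsCompact C) {z₀ : P} (hz : z₀ ∈ V) {ε : ℝ}
    (hε : 0 < ε) : ∀ᶠ z in 𝓝 z₀, ∀ x, ‖φ z x - φ z₀ x‖ ≤ ε := by
  have key : ∀ x ∈ C, ∀ᶠ p : P × M in 𝓝 (z₀, x), ‖φ p.1 p.2 - φ z₀ p.2‖ ≤ ε := fun x _ => by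
    have h1 := h.smooth z₀ hz x
    have h2 : ContMDiffAt (𝓘(ℝ, P).prod (𝓡 n)) ((𝓡 n).prod 𝓘(ℝ, F)) ∞
        (fun p : P × M => TotalSpace.mk' F p.2 (φ z₀ p.2)) (z₀, x) :=
      h1.comp (f := fun p : P × M => (z₀, p.2)) (z₀, x) (contMDiffAt_const.prodMk contMDiffAt_snd)
    have h3 : ContinuousAt (fun p : P × M => ‖φ p.1 p.2 - φ z₀ p.2‖ ^ 2) (z₀, x) := by
      simp only [@norm_sub_sq ℂ, ← @inner_self_eq_norm_sq ℂ]
      exact (((contMDiffAt_re_inner h1 h1).continuousAt).sub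
        (continuousAt_const.mul (contMDiffAt_re_inner h1 h2).continuousAt)).add
        (contMDiffAt_re_inner h2 h2).continuousAt
    have h4 := h3.eventually_lt (continuousAt_const (y := ε ^ 2)) (by simpa using by positivity)
    filter_upwards [h4] with p hp
    exact (pow_le_pow_iff_left₀ (norm_nonneg _) hε.le two_ne_zero).1 hp.le
  filter_upwards [hC.eventually_forall_of_forall_eventually
    (P := fun z x => ‖φ z x - φ z₀ x‖ ≤ ε) key, hV.mem_nhds hz] with z hz1 hz2 x
  by_cases hx : x ∈ C
  · exact hz1 x hx
  · rw [h.eq_zero z hz2 x hx, h.eq_zero z₀ hz x hx, sub_zero, norm_zero]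
    exact hε.le

/-- Differentiability uniform in `x`: the partial derivatives are again smooth families, hence vary
uniformly little near `z₀`, and the mean value inequality is applied in each fibre. -/
theorem IsSmoothFamily.eventually_norm_sub_sub_le [FiniteDimensional ℝ P] [IsManifold (𝓡 n) ∞ M]
    [IsSmoothHermitianBundle n F E]
    (h : IsSmoothFamily n F V C φ) (hV : IsOpen V) (hC : IsCompact C) {z₀ : P} (hz : z₀ ∈ V) {ε : ℝ}
    (hε : 0 < ε) : ∀ᶠ z in 𝓝 z₀, ∀ x,
      ‖φ z x - φ z₀ x - _root_.fderiv ℝ (fun z => φ z x) z₀ (z - z₀)‖ ≤ ε * ‖z - z₀‖ := by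
  let b := Module.finBasis ℝ P
  -- The factor by which `b.opNorm_le` bounds an operator norm through values on the basis. It may
  -- vanish, hence the division by `c + 1`.
  set c : ℝ := Fintype.card (Fin (Module.finrank ℝ P)) *
    ‖(b.equivFunL : P →L[ℝ] (Fin (Module.finrank ℝ P) → ℝ))‖ with hc
  have hc0 : 0 ≤ c := by positivity
  have h1 : ∀ᶠ z in 𝓝 z₀, ∀ i x, ‖_root_.fderiv ℝ (fun z => φ z x) z (b i) -
      _root_.fderiv ℝ (fun z => φ z x) z₀ (b i)‖ ≤ ε / (c + 1) :=
    Filter.eventually_all.2 fun i =>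
      (h.fderiv hV (b i)).eventually_norm_sub_le hV hC hz (by positivity)
  obtain ⟨δ, hδ, hball⟩ := Metric.eventually_nhds_iff_ball.1 (h1.and (hV.mem_nhds hz))
  filter_upwards [Metric.ball_mem_nhds z₀ hδ] with z hzδ x
  refine Convex.norm_image_sub_le_of_norm_hasFDerivWithin_le'
    (f' := fun w => _root_.fderiv ℝ (fun z => φ z x) w) (s := Metric.ball z₀ δ)
    (fun w hw => (h.differentiableAt (hball w hw).2 x).hasFDerivAt.hasFDerivWithinAt)
    (fun w hw => ?_) (convex_ball _ _) (Metric.mem_ball_self hδ) hzδ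
  refine (b.opNorm_le (M := ε / (c + 1)) (by positivity) fun i => (hball w hw).1 i x).trans ?_
  rw [nsmul_eq_mul, ← hc, ← mul_div_assoc, div_le_iff₀ (by positivity)]
  nlinarith

end Families

end Geometry

section L2

variable {n : ℕ} {M : Type*} [TopologicalSpace M] [T2Space M]
  [ChartedSpace (EuclideanSpace ℝ (Fin n)) M] [MeasurableSpace M] [BorelSpace M]
  {F : Type*} [NormedAddCommGroup F] [NormedSpace ℂ F]
  {E : M → Type*} [TopologicalSpace (TotalSpace F E)] [∀ x, NormedAddCommGroup (E x)]
  [∀ x, InnerProductSpace ℂ (E x)] [FiberBundle F E] [VectorBundle ℂ F E] [VectorBundle ℝ F E]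
  [IsSmoothHermitianBundle n F E] {μ : Measure M} [IsSmoothPositiveDensity n μ]
  {H : Type*} [NormedAddCommGroup H] [InnerProductSpace ℂ H] (j : TestSection n F E μ →ₗᵢ[ℂ] H)

/-! ### Test sections as elements of a Hilbert space -/

variable (μ) in
/-- A section in `C₀^∞(M; E)` as an element of the pre-Hilbert space `TestSection n F E μ`. -/
def TestSection.mk (u : ∀ x, E x) (hu : u ∈ testSections n F E) : TestSection n F E μ := ⟨u, hu⟩

open Classical in
/-- The element of `H` represented by the section `u`, which is `0` unless `u ∈ C₀^∞(M; E)`. -/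
def ofSection (u : ∀ x, E x) : H :=
  if h : u ∈ testSections n F E then j (.mk μ u h) else 0

theorem ofSection_of_mem {u : ∀ x, E x} (h : u ∈ testSections n F E) :
    ofSection j u = j (.mk μ u h) := dif_pos h

theorem ofSection_add {u v : ∀ x, E x} (hu : u ∈ testSections n F E) (hv : v ∈ testSections n F E) :
    ofSection j (u + v) = ofSection j u + ofSection j v := by
  rw [ofSection_of_mem j hu, ofSection_of_mem j hv, ofSection_of_mem j (add_mem hu hv)]
  exact map_add j (.mk μ u hu) (.mk μ v hv)

theorem ofSection_smul (c : ℂ) {u : ∀ x, E x} (hu : u ∈ testSections n F E) :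
    ofSection j (c • u) = c • ofSection j u := by
  rw [ofSection_of_mem j hu, ofSection_of_mem j (Submodule.smul_mem _ c hu)]
  exact map_smul j c (TestSection.mk μ u hu)

theorem ofSection_sub {u v : ∀ x, E x} (hu : u ∈ testSections n F E) (hv : v ∈ testSections n F E) :
    ofSection j (u - v) = ofSection j u - ofSection j v := by
  rw [ofSection_of_mem j hu, ofSection_of_mem j hv, ofSection_of_mem j (sub_mem hu hv)]
  exact map_sub j (.mk μ u hu) (.mk μ v hv)

theorem inner_ofSection (v : TestSection n F E μ) {u : ∀ x, E x} (hu : u ∈ testSections n F E) :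
    inner ℂ (j v) (ofSection j u) = ∫ x, inner ℂ (v x) (u x) ∂μ := by
  rw [ofSection_of_mem j hu, j.inner_map_map]
  rfl

/-- The passage from uniform to `L²` estimates; a compact set has finite measure. -/
theorem norm_ofSection_le {u : ∀ x, E x} (hu : u ∈ testSections n F E) {C : Set M}
    (hC : IsCompact C) (huC : ∀ x ∉ C, u x = 0) {ε : ℝ} (hε : 0 ≤ ε) (h : ∀ x, ‖u x‖ ≤ ε) :
    ‖ofSection j u‖ ≤ ε * √(μ.real C) := by
  have := IsSmoothPositiveDensity.isLocallyFiniteMeasure n μ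
  have h1 : ‖ofSection j u‖ ^ 2 = ‖∫ x, inner ℂ (u x) (u x) ∂μ‖ := by
    have := inner_ofSection j (.mk μ u hu) hu
    rw [← ofSection_of_mem j hu, inner_self_eq_norm_sq_to_K] at this
    change _ = ∫ x, inner ℂ (u x) (u x) ∂μ at this
    rw [← this]
    simp
  have h2 : ∫ x, inner ℂ (u x) (u x) ∂μ = ∫ x in C, inner ℂ (u x) (u x) ∂μ := by
    refine (setIntegral_eq_integral_of_forall_compl_eq_zero fun x hx => ?_).symm
    rw [huC x hx, inner_zero_left]
  have h3 : ‖∫ x in C, inner ℂ (u x) (u x) ∂μ‖ ≤ ε ^ 2 * μ.real C := by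
    refine norm_setIntegral_le_of_norm_le_const hC.measure_lt_top fun x _ => ?_
    refine (norm_inner_le_norm _ _).trans ?_
    rw [← sq]
    exact pow_le_pow_left₀ (norm_nonneg _) (h x) 2
  refine le_of_sq_le_sq ?_ (by positivity)
  rw [mul_pow, Real.sq_sqrt measureReal_nonneg, h1, h2]
  exact h3

/-! ### Smooth families as smooth maps to a Hilbert space -/

section Families

variable {P : Type*} [NormedAddCommGroup P] [NormedSpace ℝ P] [FiniteDimensional ℝ P]
  [IsManifold (𝓡 n) ∞ M] {V : Set P} {C : Set M} {φ : P → ∀ x, E x}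

/-- The fixed compact set `C` turns the uniform first-order expansion into one in the Hilbert space,
so the derivative there is the pointwise one. -/
theorem IsSmoothFamily.exists_hasFDerivAt (h : IsSmoothFamily n F V C φ) (hV : IsOpen V)
    (hC : IsCompact C) {z₀ : P} (hz : z₀ ∈ V) :
    ∃ L : P →L[ℝ] H, HasFDerivAt (fun z => ofSection j (φ z)) L z₀ ∧
      ∀ v, L v = ofSection j (fun x => _root_.fderiv ℝ (fun z => φ z x) z₀ v) := by
  have hmem : ∀ v, (fun x => _root_.fderiv ℝ (fun z => φ z x) z₀ v) ∈ testSections n F E :=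
    fun v => (h.fderiv hV v).mem_testSections hC hz
  let L : P →ₗ[ℝ] H :=
    { toFun := fun v => ofSection j (fun x => _root_.fderiv ℝ (fun z => φ z x) z₀ v)
      map_add' := fun v w => by
        rw [← ofSection_add j (hmem v) (hmem w)]
        simp only [map_add]
        rfl
      map_smul' := fun r v => by
        rw [RingHom.id_apply, ← Complex.coe_smul, ← ofSection_smul j (r : ℂ) (hmem v)]
        simp only [map_smul]
        rfl }
  refine ⟨L.toContinuousLinearMap, ?_, fun _ => rfl⟩
  refine .of_isLittleO (Asymptotics.isLittleO_iff.2 fun c hc => ?_)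
  have hε : 0 < c / (√(μ.real C) + 1) := by positivity
  filter_upwards [h.eventually_norm_sub_sub_le hV hC hz hε, hV.mem_nhds hz] with z h1 hzV
  have hsub := sub_mem (sub_mem (h.mem_testSections hC hzV) (h.mem_testSections hC hz))
    (hmem (z - z₀))
  have h2 : ofSection j (φ z) - ofSection j (φ z₀) - L.toContinuousLinearMap (z - z₀) =
      ofSection j (φ z - φ z₀ - fun x => _root_.fderiv ℝ (fun z => φ z x) z₀ (z - z₀)) := by
    rw [ofSection_sub j (sub_mem (h.mem_testSections hC hzV) (h.mem_testSections hC hz))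
      (hmem (z - z₀)), ofSection_sub j (h.mem_testSections hC hzV) (h.mem_testSections hC hz)]
    rfl
  rw [h2]
  refine (norm_ofSection_le j hsub hC (fun x hx => ?_) (by positivity) h1).trans ?_
  · simp only [Pi.sub_apply, h.eq_zero z hzV x hx, h.eq_zero z₀ hz x hx,
      (h.fderiv hV (z - z₀)).eq_zero z₀ hz x hx, sub_zero]
  · rw [mul_right_comm]
    refine mul_le_mul_of_nonneg_right ?_ (norm_nonneg _)
    rw [div_mul_eq_mul_div, div_le_iff₀ (by positivity)]
    nlinarith

/-- The induction runs over all families at once, because each directional derivative is a smooth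
family vanishing off the same `C`. -/
theorem IsSmoothFamily.contDiffOn_nat (m : ℕ) (h : IsSmoothFamily n F V C φ) (hV : IsOpen V)
    (hC : IsCompact C) : ContDiffOn ℝ m (fun z => ofSection j (φ z)) V := by
  induction m generalizing φ with
  | zero =>
    refine contDiffOn_zero.2 fun z hz => ?_
    obtain ⟨L, hL, -⟩ := h.exists_hasFDerivAt j hV hC hz
    exact hL.continuousAt.continuousWithinAt
  | succ m ih =>
    rw [Nat.cast_add, Nat.cast_one, contDiffOn_succ_iff_fderiv_of_isOpen hV]
    refine ⟨fun z hz => ?_, by simp, ?_⟩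
    · obtain ⟨L, hL, -⟩ := h.exists_hasFDerivAt j hV hC hz
      exact hL.differentiableAt.differentiableWithinAt
    · refine contDiffOn_clm_apply.2 fun v => (ih (h.fderiv hV v)).congr fun z hz => ?_
      obtain ⟨L, hL, hLv⟩ := h.exists_hasFDerivAt j hV hC hz
      rw [hL.fderiv, hLv]

theorem IsSmoothFamily.contDiffOn (h : IsSmoothFamily n F V C φ) (hV : IsOpen V)
    (hC : IsCompact C) : ContDiffOn ℝ ∞ (fun z => ofSection j (φ z)) V :=
  contDiffOn_infty.2 fun m => h.contDiffOn_nat j m hV hC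

end Families

/-! ### The operator defined by a properly supported kernel -/

section Kernels

variable {K : ∀ x y : M, E y →L[ℂ] E x}

/-- One compact set serves all `y ∈ D`, as the definition of a smooth family requires. -/
theorem IsProperlySupported.exists_isCompact (hKs : IsProperlySupported K) {D : Set M}
    (hD : IsCompact D) : ∃ C : Set M, IsCompact C ∧ ∀ y ∈ D, ∀ x ∉ C, K x y = 0 := by
  refine ⟨Prod.fst '' (closure {p : M × M | K p.1 p.2 ≠ 0} ∩ Prod.snd ⁻¹' D),
    (hKs D hD).2.image continuous_fst, fun y hy x hx => ?_⟩
  by_contra hne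
  exact hx ⟨(x, y), ⟨subset_closure hne, hy⟩, rfl⟩

theorem IsSmoothKernel.mem_testSections (hK : IsSmoothKernel n F E K)
    (hKs : IsProperlySupported K) (y : M) (η : E y) :
    (fun x => K x y η) ∈ testSections n F E := by
  obtain ⟨C, hC, h⟩ := hKs.exists_isCompact (isCompact_singleton (x := y))
  refine ⟨fun x => ?_, C, hC, fun x hx => by simp [h y rfl x hx]⟩
  exact hK.contMDiffAt_apply (b := fun _ => y) (s := fun _ => η) contMDiffAt_id contMDiffAt_const

theorem finiteDimensional_fiber (F : Type*) [NormedAddCommGroup F] [NormedSpace ℂ F]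
    [FiniteDimensional ℂ F]
    [TopologicalSpace (TotalSpace F E)] [FiberBundle F E] [VectorBundle ℂ F E] (y : M) :
    FiniteDimensional ℂ (E y) :=
  ((trivializationAt F E y).continuousLinearEquivAt ℂ y
    (FiberBundle.mem_baseSet_trivializationAt' y)).symm.toLinearEquiv.finiteDimensional

variable [FiniteDimensional ℂ F]

/-- The map `η ↦ K(·, y) η` from the fibre `E y` to the Hilbert space. -/
def kernelMap (hK : IsSmoothKernel n F E K) (hKs : IsProperlySupported K) (y : M) : E y →L[ℂ] H :=
  have := finiteDimensional_fiber (E := E) F y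
  LinearMap.toContinuousLinearMap
    { toFun := fun η => ofSection j (fun x => K x y η)
      map_add' := fun η ξ => by
        rw [← ofSection_add j (hK.mem_testSections hKs y η) (hK.mem_testSections hKs y ξ)]
        simp only [map_add]
        rfl
      map_smul' := fun c η => by
        rw [RingHom.id_apply, ← ofSection_smul j c (hK.mem_testSections hKs y η)]
        simp only [map_smul]
        rfl }

theorem kernelMap_apply (hK : IsSmoothKernel n F E K) (hKs : IsProperlySupported K) (y : M)
    (η : E y) : kernelMap j hK hKs y η = ofSection j (fun x => K x y η) := rfl

variable [IsManifold (𝓡 n) ∞ M]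

/-- The smoothing property of `K`. In a chart around `y₀`, with `y` confined to a compact
neighbourhood `D`, the sections `K(·, y) s(y)` form a smooth family with common compact support. -/
theorem contMDiffAt_kernelMap (hK : IsSmoothKernel n F E K) (hKs : IsProperlySupported K)
    {U : Set M} (hU : IsOpen U) {s : ∀ y, E y} (hs : ∀ y ∈ U, ContMDiffAt (𝓡 n)
      ((𝓡 n).prod 𝓘(ℝ, F)) ∞ (fun y => TotalSpace.mk' F y (s y)) y) {y₀ : M} (hy : y₀ ∈ U) :
    ContMDiffAt (𝓡 n) 𝓘(ℝ, H) ∞ (fun y => kernelMap j hK hKs y (s y)) y₀ := by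
  have : LocallyCompactSpace M := ChartedSpace.locallyCompactSpace (EuclideanSpace ℝ (Fin n)) M
  obtain ⟨D, hD, hyD, hDU⟩ := exists_compact_subset hU hy
  obtain ⟨C, hC, hKC⟩ := hKs.exists_isCompact hD
  set c := chartAt (EuclideanSpace ℝ (Fin n)) y₀
  set V : Set (EuclideanSpace ℝ (Fin n)) := c.target ∩ c.symm ⁻¹' interior D
  have hV : IsOpen V := c.symm.isOpen_inter_preimage isOpen_interior
  have hfam : IsSmoothFamily n F V C (fun z x => K x (c.symm z) (s (c.symm z))) := by
    refine ⟨fun z hz x => ?_, fun z hz x hx => ?_⟩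
    · have h1 : ContMDiffAt (𝓡 n) (𝓡 n) ∞ c.symm z :=
        (contMDiffOn_chart_symm (I := 𝓡 n) (n := ∞)).contMDiffAt (c.open_target.mem_nhds hz.1)
      have h2 : ContMDiffAt (𝓘(ℝ, EuclideanSpace ℝ (Fin n)).prod (𝓡 n)) (𝓡 n) ∞
          (fun p : EuclideanSpace ℝ (Fin n) × M => c.symm p.1) (z, x) :=
        h1.comp (z, x) contMDiffAt_fst
      exact hK.contMDiffAt_apply (s := fun p : EuclideanSpace ℝ (Fin n) × M => s (c.symm p.1))
        contMDiffAt_snd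
        ((hs _ (hDU (interior_subset hz.2))).comp
          (f := fun p : EuclideanSpace ℝ (Fin n) × M => c.symm p.1) (z, x) h2)
    · rw [hKC _ (interior_subset hz.2) x hx]
      rfl
  have hyc : y₀ ∈ c.source := mem_chart_source _ y₀
  have hcV : c y₀ ∈ V := ⟨c.map_source hyc, by rwa [Set.mem_preimage, c.left_inv hyc]⟩
  have h3 := ((hfam.contDiffOn j hV hC).contDiffAt (hV.mem_nhds hcV)).contMDiffAt
  have h4 : ContMDiffAt (𝓡 n) 𝓘(ℝ, EuclideanSpace ℝ (Fin n)) ∞ c y₀ :=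
    (contMDiffOn_chart (I := 𝓡 n) (n := ∞)).contMDiffAt (c.open_source.mem_nhds hyc)
  refine (h3.comp y₀ h4).congr_of_eventuallyEq ?_
  filter_upwards [c.open_source.mem_nhds hyc] with y hy'
  simp only [Function.comp_apply]
  rw [c.left_inv hy', kernelMap_apply]

theorem continuous_kernelMap (hK : IsSmoothKernel n F E K) (hKs : IsProperlySupported K)
    (u : TestSection n F E μ) : Continuous (fun y => kernelMap j hK hKs y (u y)) :=
  continuous_iff_continuousAt.2 fun y =>
    (contMDiffAt_kernelMap j hK hKs isOpen_univ (fun y _ => u.2.1 y) (Set.mem_univ y)).continuousAt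

variable [SecondCountableTopology M]

theorem integrable_kernelMap (hK : IsSmoothKernel n F E K) (hKs : IsProperlySupported K)
    (u : TestSection n F E μ) : Integrable (fun y => kernelMap j hK hKs y (u y)) μ := by
  have := IsSmoothPositiveDensity.isLocallyFiniteMeasure n μ
  refine (continuous_kernelMap j hK hKs u).integrable_of_hasCompactSupport ?_
  obtain ⟨C, hC, huC⟩ := u.2.2
  exact HasCompactSupport.intro hC fun x hx => by rw [huC x hx, map_zero]

/-- The operator `u ↦ ∫ K(·, y) u(y) dμ(y)` from `C₀^∞(M; E)` to the Hilbert space. -/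
def kernelOp (hK : IsSmoothKernel n F E K) (hKs : IsProperlySupported K) :
    TestSection n F E μ →ₗ[ℂ] H where
  toFun u := ∫ y, kernelMap j hK hKs y (u y) ∂μ
  map_add' u v := by
    rw [← integral_add (integrable_kernelMap j hK hKs u) (integrable_kernelMap j hK hKs v)]
    exact integral_congr_ae (Filter.Eventually.of_forall fun y => map_add _ (u y) (v y))
  map_smul' c u := by
    rw [RingHom.id_apply, ← integral_smul]
    exact integral_congr_ae (Filter.Eventually.of_forall fun y => map_smul _ c (u y))

theorem continuous_inner_kernel {k : ∀ x y : M, E y →L[ℂ] E x} (hk : IsSmoothKernel n F E k)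
    (v u : TestSection n F E μ) :
    Continuous (fun p : M × M => inner ℂ (v p.1) (k p.1 p.2 (u p.2))) :=
  continuous_iff_continuousAt.2 fun p =>
    continuousAt_inner (I := (𝓡 n).prod (𝓡 n)) (b := fun p : M × M => p.1)
      ((v.2.1 p.1).comp p contMDiffAt_fst)
      (hk.contMDiffAt_apply (b := fun p : M × M => p.2) (s := fun p : M × M => u p.2)
        contMDiffAt_fst ((u.2.1 p.2).comp p contMDiffAt_snd))

theorem hasCompactSupport_inner_kernel (k : ∀ x y : M, E y →L[ℂ] E x)
    (v u : TestSection n F E μ) :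
    HasCompactSupport (fun p : M × M => inner ℂ (v p.1) (k p.1 p.2 (u p.2))) := by
  obtain ⟨C, hC, hvC⟩ := v.2.2
  obtain ⟨D, hD, huD⟩ := u.2.2
  refine HasCompactSupport.intro (hC.prod hD) fun p hp => ?_
  by_cases h : p.1 ∈ C
  · rw [huD p.2 fun h' => hp ⟨h, h'⟩, map_zero, inner_zero_right]
  · rw [hvC p.1 h, inner_zero_left]

/-- Fubini for a continuous, compactly supported integrand: the vector-valued integral pairs with
`v` in the order `dx dy`, the kernel pairing in the order `dy dx`. -/
theorem inner_kernelOp [CompleteSpace H] (hK : IsSmoothKernel n F E K)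
    (hKs : IsProperlySupported K) (v u : TestSection n F E μ) :
    inner ℂ (j v) (kernelOp j hK hKs u) = kernelPairing K v u := by
  have := IsSmoothPositiveDensity.isLocallyFiniteMeasure n μ
  rw [show kernelOp j hK hKs u = ∫ y, kernelMap j hK hKs y (u y) ∂μ from rfl,
    ← integral_inner (integrable_kernelMap j hK hKs u), kernelPairing,
    integral_integral_swap_of_hasCompactSupport (f := fun x y => inner ℂ (v x) (K x y (u y)))
      (continuous_inner_kernel hK v u)
      (hasCompactSupport_inner_kernel K v u)]
  refine integral_congr_ae (Filter.Eventually.of_forall fun y => ?_)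
  exact inner_ofSection j v (hK.mem_testSections hKs y (u y))

theorem kernelPairing_smul_sub {k l : ∀ x y : M, E y →L[ℂ] E x} (hk : IsSmoothKernel n F E k)
    (hl : IsSmoothKernel n F E l) (c : ℂ) (v u : TestSection n F E μ) :
    kernelPairing (fun x y => c • k x y - l x y) v u =
      c * kernelPairing k v u - kernelPairing l v u := by
  have := IsSmoothPositiveDensity.isLocallyFiniteMeasure n μ
  have hint : ∀ {k : ∀ x y : M, E y →L[ℂ] E x}, IsSmoothKernel n F E k →
      Integrable (fun p : M × M => inner ℂ (v p.1) (k p.1 p.2 (u p.2))) (μ.prod μ) := fun hk =>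
    (continuous_inner_kernel hk v u).integrable_of_hasCompactSupport
      (hasCompactSupport_inner_kernel _ v u)
  have hsub := integral_prod _ (((hint hk).const_mul c).sub (hint hl))
  rw [integral_sub' ((hint hk).const_mul c) (hint hl), integral_const_mul, integral_prod _ (hint hk),
    integral_prod _ (hint hl)] at hsub
  refine Eq.trans ?_ hsub.symm
  rw [kernelPairing]
  refine integral_congr_ae (Filter.Eventually.of_forall fun x => ?_)
  refine integral_congr_ae (Filter.Eventually.of_forall fun y => ?_)
  simp only [Pi.sub_apply]
  rw [← inner_smul_right, ← inner_sub_right]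
  rfl

end Kernels

end L2

/-! ### Smoothness of maps to finite-dimensional spaces -/

section FiniteDimensional

variable {EN : Type*} [NormedAddCommGroup EN] [NormedSpace ℝ EN] {HN : Type*} [TopologicalSpace HN]
  {I : ModelWithCorners ℝ EN HN} {N : Type*} [TopologicalSpace N] [ChartedSpace HN N]
  {X : Type*} [NormedAddCommGroup X] [NormedSpace ℝ X] [FiniteDimensional ℝ X]

/-- Smoothness of a map to a finite-dimensional space can be checked on finitely many functionals
which separate points. -/
theorem contMDiffAt_of_injective {Y ι : Type*} [NormedAddCommGroup Y] [NormedSpace ℝ Y]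
    [FiniteDimensional ℝ Y] [Fintype ι] (L : X →ₗ[ℝ] ι → Y) (hL : Function.Injective L)
    {f : N → X} {p₀ : N} (hf : ∀ i, ContMDiffAt I 𝓘(ℝ, Y) ∞ (fun p => L (f p) i) p₀) :
    ContMDiffAt I 𝓘(ℝ, X) ∞ f p₀ := by
  obtain ⟨G, hG⟩ := L.exists_leftInverse_of_injective (LinearMap.ker_eq_bot.2 hL)
  have h1 : ContMDiffAt I 𝓘(ℝ, ι → Y) ∞ (fun p => L (f p)) p₀ := contMDiffAt_pi_space.2 hf
  have h2 : ContDiff ℝ ∞ G.toContinuousLinearMap := G.toContinuousLinearMap.contDiff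
  refine (h2.contMDiff.contMDiffAt.comp p₀ h1).congr_of_eventuallyEq
    (Filter.Eventually.of_forall fun p => ?_)
  exact (LinearMap.congr_fun hG (f p)).symm

end FiniteDimensional

section L2

variable {n : ℕ} {M : Type*} [TopologicalSpace M] [T2Space M]
  [ChartedSpace (EuclideanSpace ℝ (Fin n)) M] [MeasurableSpace M] [BorelSpace M]
  {F : Type*} [NormedAddCommGroup F] [NormedSpace ℂ F]
  {E : M → Type*} [TopologicalSpace (TotalSpace F E)] [∀ x, NormedAddCommGroup (E x)]
  [∀ x, InnerProductSpace ℂ (E x)] [FiberBundle F E] [VectorBundle ℂ F E] [VectorBundle ℝ F E]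

/-! ### Local frames, and smoothness tested by inner products -/

section Frame

variable (F E) in
/-- The local section of `E` which is constant with value `f` in the trivialization at `x₀`. -/
def localFrame (x₀ : M) (f : F) (y : M) : E y := (trivializationAt F E x₀).symmL ℂ y f

theorem trivialization_localFrame {x₀ y : M} (hy : y ∈ (trivializationAt F E x₀).baseSet) (f : F) :
    (trivializationAt F E x₀).continuousLinearMapAt ℂ y (localFrame F E x₀ f y) = f :=
  (trivializationAt F E x₀).continuousLinearMapAt_symmL hy f

theorem localFrame_trivialization {x₀ y : M} (hy : y ∈ (trivializationAt F E x₀).baseSet)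
    (v : E y) :
    localFrame F E x₀ ((trivializationAt F E x₀).continuousLinearMapAt ℂ y v) y = v :=
  (trivializationAt F E x₀).symmL_continuousLinearMapAt hy v

theorem contMDiffAt_localFrame [ContMDiffVectorBundle ∞ F E (𝓡 n)] {x₀ y : M}
    (hy : y ∈ (trivializationAt F E x₀).baseSet) (f : F) :
    ContMDiffAt (𝓡 n) ((𝓡 n).prod 𝓘(ℝ, F)) ∞
      (fun y => TotalSpace.mk' F y (localFrame F E x₀ f y)) y := by
  rw [(trivializationAt F E x₀).contMDiffAt_section_iff hy]
  refine (contMDiffAt_const (c := f)).congr_of_eventuallyEq ?_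
  filter_upwards [(trivializationAt F E x₀).open_baseSet.mem_nhds hy] with w hw
  have := trivialization_localFrame (E := E) hw f
  rwa [Trivialization.continuousLinearMapAt_apply, Trivialization.linearMapAt_apply,
    if_pos hw] at this

variable {EN : Type*} [NormedAddCommGroup EN] [NormedSpace ℝ EN] {HN : Type*} [TopologicalSpace HN]
  {I : ModelWithCorners ℝ EN HN} {N : Type*} [TopologicalSpace N] [ChartedSpace HN N]

/-- A section along a map is smooth if its inner products with all local frame sections are. -/
theorem contMDiffAt_of_inner_localFrame [FiniteDimensional ℂ F]
    [ContMDiffVectorBundle ∞ F E (𝓡 n)] [IsSmoothHermitianBundle n F E] {a : N → M}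
    {s : ∀ p, E (a p)} {p₀ : N} (ha : ContMDiffAt I (𝓡 n) ∞ a p₀)
    (h : ∀ f : F, ContMDiffAt I 𝓘(ℝ) ∞
      (fun p => (inner ℂ (localFrame F E (a p₀) f (a p)) (s p)).re) p₀) :
    ContMDiffAt I 𝓘(ℝ, F) ∞
      (fun p => (trivializationAt F E (a p₀)).continuousLinearMapAt ℂ (a p) (s p)) p₀ := by
  set e := trivializationAt F E (a p₀) with he
  have hp₀ : a p₀ ∈ e.baseSet := FiberBundle.mem_baseSet_trivializationAt' _
  let b := Module.finBasis ℝ F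
  let ι := Fin (Module.finrank ℝ F)
  -- the Gram operator of the frame
  let Γ : M → F →L[ℝ] (ι → ℝ) := fun y => LinearMap.toContinuousLinearMap
    { toFun := fun f i => (inner ℂ (localFrame F E (a p₀) (b i) y) (localFrame F E (a p₀) f y)).re
      map_add' := fun f g => by
        funext i
        simp only [localFrame, map_add, inner_add_right, Complex.add_re, Pi.add_apply]
      map_smul' := fun r f => by
        funext i
        simp only [localFrame, ← Complex.coe_smul, map_smul, inner_smul_right, Pi.smul_apply,
          RingHom.id_apply, smul_eq_mul, Complex.re_ofReal_mul] }
  have hΓ : ∀ y f i, Γ y f i =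
    (inner ℂ (localFrame F E (a p₀) (b i) y) (localFrame F E (a p₀) f y)).re := fun _ _ _ => rfl
  have hΓsmooth : ContMDiffAt (𝓡 n) 𝓘(ℝ, F →L[ℝ] (ι → ℝ)) ∞ Γ (a p₀) := by
    let L : (F →L[ℝ] (ι → ℝ)) →ₗ[ℝ] ι → (ι → ℝ) :=
      { toFun := fun A k => A (b k)
        map_add' := fun _ _ => rfl
        map_smul' := fun _ _ => rfl }
    refine contMDiffAt_of_injective L (fun A B hAB => ?_) fun k => contMDiffAt_pi_space.2 fun i => ?_
    · exact ContinuousLinearMap.coe_injective (b.ext fun k => congrFun hAB k)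
    · exact contMDiffAt_re_inner (b := fun y : M => y) (contMDiffAt_localFrame hp₀ (b i))
        (contMDiffAt_localFrame hp₀ (b k))
  -- If `Γ y f = 0`, the frame section of `f` at `y` is orthogonal, for the real inner product, to
  -- all frame sections, in particular to itself.
  have hΓinj : ∀ y ∈ e.baseSet, Function.Injective (Γ y) := fun y hy => by
    refine (injective_iff_map_eq_zero _).2 fun f hf => ?_
    let ℓ : F →ₗ[ℝ] ℝ :=
      { toFun := fun g => (inner ℂ (localFrame F E (a p₀) g y) (localFrame F E (a p₀) f y)).re
        map_add' := fun f g => by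
          simp only [localFrame, map_add, inner_add_left, Complex.add_re]
        map_smul' := fun r f => by
          simp only [localFrame, ← Complex.coe_smul, map_smul, inner_smul_left,
            RingHom.id_apply, smul_eq_mul, Complex.re_ofReal_mul, Complex.conj_ofReal] }
    have hℓ : ℓ = 0 := b.ext fun i => congrFun hf i
    have h0 : localFrame F E (a p₀) f y = 0 :=
      (inner_self_eq_zero (𝕜 := ℂ)).1
        (Complex.ext (LinearMap.congr_fun hℓ f) (inner_self_im (𝕜 := ℂ) _))
    rw [← trivialization_localFrame hy f, h0, map_zero]
  have hequiv : ∀ y ∈ e.baseSet, ∃ Λ : F ≃L[ℝ] (ι → ℝ), (Λ : F →L[ℝ] (ι → ℝ)) = Γ y :=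
    fun y hy => by
      have hfin : Module.finrank ℝ F = Module.finrank ℝ (ι → ℝ) := by simp [ι]
      refine ⟨(LinearMap.linearEquivOfInjective (Γ y : F →ₗ[ℝ] (ι → ℝ)) (hΓinj y hy)
        hfin).toContinuousLinearEquiv, ?_⟩
      ext f
      rfl
  obtain ⟨Λ, hΛ⟩ := hequiv _ hp₀
  -- The coordinates of `s` are the inverse Gram operator applied to its inner products with the
  -- frame, and inversion is smooth at invertible operators.
  have hinv : ContMDiffAt I 𝓘(ℝ, (ι → ℝ) →L[ℝ] F) ∞
      (fun p => ContinuousLinearMap.inverse (Γ (a p))) p₀ := by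
    have h1 : ContDiffAt ℝ ∞ ContinuousLinearMap.inverse (Γ (a p₀)) :=
      hΛ ▸ contDiffAt_map_inverse Λ
    exact h1.contMDiffAt.comp p₀ (hΓsmooth.comp p₀ ha)
  have hℓ : ContMDiffAt I 𝓘(ℝ, ι → ℝ) ∞
      (fun p i => (inner ℂ (localFrame F E (a p₀) (b i) (a p)) (s p)).re) p₀ :=
    contMDiffAt_pi_space.2 fun i => h (b i)
  refine (hinv.clm_apply hℓ).congr_of_eventuallyEq ?_
  filter_upwards [ha.continuousAt.preimage_mem_nhds (e.open_baseSet.mem_nhds hp₀)] with p hp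
  obtain ⟨Λ', hΛ'⟩ := hequiv _ hp
  have h2 : (fun i => (inner ℂ (localFrame F E (a p₀) (b i) (a p)) (s p)).re) =
      Λ' (e.continuousLinearMapAt ℂ (a p) (s p)) := by
    funext i
    rw [← ContinuousLinearEquiv.coe_coe, hΛ', hΓ, localFrame_trivialization hp]
  rw [h2, ← hΛ', ContinuousLinearMap.inverse_equiv]
  exact (Λ'.symm_apply_apply _).symm

end Frame

/-! ### Smooth kernels of the form `κ(x)* S κ(y)` -/

variable [IsSmoothHermitianBundle n F E] {μ : Measure M} [IsSmoothPositiveDensity n μ]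
  {H : Type*} [NormedAddCommGroup H] [InnerProductSpace ℂ H] [CompleteSpace H]
  (j : TestSection n F E μ →ₗᵢ[ℂ] H) [FiniteDimensional ℂ F]
  {K : ∀ x y : M, E y →L[ℂ] E x}

/-- The kernel `κ(x)* S κ(y)` with `κ(y) η = K(·, y) η`. -/
def sandwichKernel (hK : IsSmoothKernel n F E K) (hKs : IsProperlySupported K) (S : H →L[ℂ] H)
    (x y : M) : E y →L[ℂ] E x :=
  have := finiteDimensional_fiber (E := E) F x
  have := FiniteDimensional.complete ℂ (E x)
  (kernelMap j hK hKs x).adjoint ∘L S ∘L kernelMap j hK hKs y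

theorem inner_sandwichKernel (hK : IsSmoothKernel n F E K) (hKs : IsProperlySupported K)
    (S : H →L[ℂ] H) {x y : M} (ξ : E x) (η : E y) :
    inner ℂ ξ (sandwichKernel j hK hKs S x y η) =
      inner ℂ (kernelMap j hK hKs x ξ) (S (kernelMap j hK hKs y η)) := by
  have := finiteDimensional_fiber (E := E) F x
  have := FiniteDimensional.complete ℂ (E x)
  exact ContinuousLinearMap.adjoint_inner_right (kernelMap j hK hKs x) ξ
    (S (kernelMap j hK hKs y η))

variable [IsManifold (𝓡 n) ∞ M] [ContMDiffVectorBundle ∞ F E (𝓡 n)]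

/-- In local frames the matrix entries are `⟨κ(x) ξ, S κ(y) η⟩`, a bounded real-bilinear expression
in two smooth `H`-valued maps, so boundedness of `S` suffices for joint smoothness. -/
theorem isSmoothKernel_sandwichKernel (hK : IsSmoothKernel n F E K) (hKs : IsProperlySupported K)
    (S : H →L[ℂ] H) : IsSmoothKernel n F E (sandwichKernel j hK hKs S) := by
  intro x₀ y₀
  have : FiniteDimensional ℝ (F →L[ℂ] F) := Module.Finite.trans ℂ _
  let b := Module.finBasis ℂ F
  let L : (F →L[ℂ] F) →ₗ[ℝ] Fin (Module.finrank ℂ F) → F :=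
    { toFun := fun A k => A (b k)
      map_add' := fun _ _ => rfl
      map_smul' := fun _ _ => rfl }
  refine contMDiffAt_of_injective L (fun A B hAB => ?_) fun k => ?_
  · exact ContinuousLinearMap.coe_injective (b.ext fun k => congrFun hAB k)
  have hframe : ∀ (z : M) (f : F), ContMDiffAt (𝓡 n) 𝓘(ℝ, H) ∞
      (fun y => kernelMap j hK hKs y (localFrame F E z f y)) z := fun z f =>
    contMDiffAt_kernelMap j hK hKs (trivializationAt F E z).open_baseSet
      (fun y hy => contMDiffAt_localFrame hy f) (FiberBundle.mem_baseSet_trivializationAt' z)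
  refine contMDiffAt_of_inner_localFrame (a := fun p : M × M => p.1) (p₀ := (x₀, y₀))
    (s := fun p => sandwichKernel j hK hKs S p.1 p.2 (localFrame F E y₀ (b k) p.2))
    contMDiffAt_fst fun f => ?_
  simp only [inner_sandwichKernel]
  have hB : ContDiff ℝ ∞ (fun q : H × H => (inner ℂ q.1 (S q.2)).re) :=
    Complex.reCLM.contDiff.comp
      (contDiff_fst.inner ℂ ((S.contDiff.restrict_scalars ℝ).comp contDiff_snd))
  exact hB.contMDiff.contMDiffAt.comp (x₀, y₀)
    (((hframe x₀ f).comp (x₀, y₀) contMDiffAt_fst).prodMk_space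
      ((hframe y₀ (b k)).comp (x₀, y₀) contMDiffAt_snd))

theorem IsSmoothKernel.smul_sub {k l : ∀ x y : M, E y →L[ℂ] E x} (hk : IsSmoothKernel n F E k)
    (hl : IsSmoothKernel n F E l) (c : ℂ) :
    IsSmoothKernel n F E (fun x y => c • k x y - l x y) := fun x₀ y₀ => by
  have hc : ContDiff ℝ ∞ (fun v : F →L[ℂ] F => c • v) := contDiff_const_smul c
  refine ((hc.contMDiff.contMDiffAt.comp (x₀, y₀) (hk x₀ y₀)).sub (hl x₀ y₀)).congr_of_eventuallyEq
    (Filter.Eventually.of_forall fun p => ?_)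
  simp [ContinuousLinearMap.inCoordinates]

variable [SecondCountableTopology M]

/-- Both vectors are Bochner integrals of `κ`, and a bounded `S` and the inner product pass under
the integral signs. -/
theorem inner_kernelOp_apply (hK : IsSmoothKernel n F E K) (hKs : IsProperlySupported K)
    (S : H →L[ℂ] H) (v u : TestSection n F E μ) :
    inner ℂ (kernelOp j hK hKs v) (S (kernelOp j hK hKs u)) =
      kernelPairing (sandwichKernel j hK hKs S) v u := by
  have hv := integrable_kernelMap j hK hKs v
  have hu := integrable_kernelMap j hK hKs u
  have h1 : ∀ w : H, inner ℂ (kernelOp j hK hKs v) w =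
      ∫ x, inner ℂ (kernelMap j hK hKs x (v x)) w ∂μ := fun w => by
    rw [← inner_conj_symm, show kernelOp j hK hKs v = ∫ y, kernelMap j hK hKs y (v y) ∂μ from rfl,
      ← integral_inner hv, ← integral_conj]
    simp only [inner_conj_symm]
  rw [h1, kernelPairing]
  refine integral_congr_ae (Filter.Eventually.of_forall fun x => ?_)
  simp only [inner_sandwichKernel]
  rw [show kernelOp j hK hKs u = ∫ y, kernelMap j hK hKs y (u y) ∂μ from rfl,
    ← S.integral_comp_comm hu, ← integral_inner (S.integrable_comp hu)]

end L2

end SmoothKernel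

end

/-! ### The main theorem -/

theorem mainTheorem10
    {n : ℕ} {M : Type*} [TopologicalSpace M] [T2Space M] [SecondCountableTopology M]
    [ChartedSpace (EuclideanSpace ℝ (Fin n)) M] [IsManifold (𝓡 n) ∞ M]
    [MeasurableSpace M] [BorelSpace M]
    {F : Type*} [NormedAddCommGroup F] [NormedSpace ℂ F] [FiniteDimensional ℂ F]
    {E : M → Type*} [TopologicalSpace (TotalSpace F E)] [∀ x, NormedAddCommGroup (E x)]
    [∀ x, InnerProductSpace ℂ (E x)] [FiberBundle F E] [VectorBundle ℂ F E] [VectorBundle ℝ F E]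
    [ContMDiffVectorBundle ∞ F E (𝓡 n)] [SmoothKernel.IsSmoothHermitianBundle n F E]
    (μ : Measure M) [SmoothKernel.IsSmoothPositiveDensity n μ]
    (K : ∀ x y : M, E y →L[ℂ] E x)
    (hK : SmoothKernel.IsSmoothKernel n F E K)
    (hKsupp : SmoothKernel.IsProperlySupported K)
    (hKnonneg : SmoothKernel.IsNonnegKernel n F μ K) :
    (∃ A : SmoothKernel.L2 n F E μ →ₗ.[ℂ] SmoothKernel.L2 n F E μ,
      SmoothKernel.IsNonnegSelfAdjointRealization A K) ∧
    ∀ A : SmoothKernel.L2 n F E μ →ₗ.[ℂ] SmoothKernel.L2 n F E μ,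
      SmoothKernel.IsNonnegSelfAdjointRealization A K →
      ∃ T : SmoothKernel.L2 n F E μ →L[ℂ] SmoothKernel.L2 n F E μ,
        SmoothKernel.IsInvSqrt (SmoothKernel.idAdd A) T ∧
        (1 - T).IsPositive ∧
        ∃ k : ∀ x y : M, E y →L[ℂ] E x,
          SmoothKernel.IsSmoothKernel n F E k ∧
          SmoothKernel.HasIntegralKernel (SmoothKernel.ofBounded (1 - T)) k := by
  let j : SmoothKernel.TestSection n F E μ →ₗᵢ[ℂ] SmoothKernel.L2 n F E μ :=
    UniformSpace.Completion.toComplₗᵢ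
  have hj : DenseRange j := UniformSpace.Completion.denseRange_coe
  have hop := SmoothKernel.inner_kernelOp j hK hKsupp
  refine ⟨?_, fun A hA => ?_⟩
  · obtain ⟨A, hA, hpos, hext⟩ := SmoothKernel.exists_isSelfAdjoint_extension
      (ι := j.toLinearMap) (κ := SmoothKernel.kernelOp j hK hKsupp) hj
      fun u => (hKnonneg u).trans_eq (hop u u).symm
    refine ⟨A, hA, hpos, fun u => ?_⟩
    obtain ⟨hu, hAu⟩ := hext u
    exact ⟨hu, fun v => (congrArg (inner ℂ (j v)) hAu).trans (hop v u)⟩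
  · obtain ⟨R, hR, hR0, hR1⟩ := SmoothKernel.exists_isBoundedInverse hA.isSelfAdjoint hA.nonneg
    obtain ⟨hpos, S, hS⟩ := SmoothKernel.exists_one_sub_sqrt_eq hR0 hR1
    have hRκ : ∀ u, R (j u + SmoothKernel.kernelOp j hK hKsupp u) = j u := fun u => by
      obtain ⟨hu, hAu⟩ := hA.hasIntegralKernel u
      -- An integral kernel prescribes `A u` only through pairings with test sections; these are
      -- dense, so `A u` is determined.
      have h1 : A ⟨j u, hu⟩ = SmoothKernel.kernelOp j hK hKsupp u := by
        refine ext_inner_left ℂ fun w => ?_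
        refine hj.induction_on w (isClosed_eq (by fun_prop) (by fun_prop)) fun v => ?_
        exact (hAu v).trans (hop v u).symm
      rw [← h1]
      exact hR.inv_apply ⟨j u, hu⟩
    -- The kernel is `K(x, y)/2 - κ(x)* S κ(y)`, read off from `hS` with `a = K u` and `b = K v`.
    refine ⟨cfc Real.sqrt R, ⟨R, hR, rfl⟩, hpos, _,
      hK.smul_sub (SmoothKernel.isSmoothKernel_sandwichKernel j hK hKsupp S) 2⁻¹, fun u => ?_⟩
    refine ⟨Submodule.mem_top, fun v => ?_⟩
    rw [SmoothKernel.kernelPairing_smul_sub hK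
      (SmoothKernel.isSmoothKernel_sandwichKernel j hK hKsupp S), ← hop,
      ← SmoothKernel.inner_kernelOp_apply]
    exact hS (j u) (j v) _ _ (hRκ u) (hRκ v)
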